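/- Let $\mathcal H$ be a complex Hilbert space, $\mathcal D\subset\mathcal H$ a dense subspace, and $T(z)$, $z\in\mathbb C$, a family of closed operators on $\mathcal H$ with common domain $\mathcal D$ such that: (i) for all $f\in\mathcal D$, $g\in\mathcal H$, the function $z\mapsto\langle T(z)f,g\rangle$ (inner product linear in the first entry) is analytic on $\mathbb C$; (ii) for every $z\in\mathbb R$, $T(z)$ is self-adjoint and has discrete spectrum, i.e. its spectrum consists of isolated points that are eigenvalues of finite multiplicity; (iii) there is $C>0$ such that $\|T'(z)\|\le C$ for all $z\in\mathbb C$, where $T'(z):\mathcal D\to\mathcal H$ is the operator with $\langle T'(z)f,g\rangle=\frac{d}{dz}\langle T(z)f,g\rangle$, and the bound means $\|T'(z)f\|\le C\|f\|$ for all $f\in\mathcal D$. Let $(a,b)\subset\mathbb R$ be a nonempty open interval (possibly unbounded), $m\ge 1$ an integer, and $\mu:(a,b)\to\mathbb R$ a continuous function such that for every $z\in(a,b)$, $\mu(z)$ is an eigenvalue of $T(z)$ of multiplicity $m$. Then there exist a closed discrete set $D\subset\mathbb R$ and an open connected set $U\subset\mathbb C$ containing $(\mathbb R\setminus D)\cup(a,b)$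 such that $\mu$ extends to an analytic function $\mu:U\to\mathbb C$ with the following properties: - for all $z\in U$, $\mu(z)$ is an eigenvalue of $T(z)$ whose eigenspace has dimension $m$; - for all $z\in U$ there is an eigenprojector $\pi(z)$ of $T(z)$ associated to $\mu(z)$, i.e. a bounded projection with range $\ker(T(z)-\mu(z))$ and kernel $\operatorname{ran}(T(z)-\mu(z))$ (in particular, the algebraic multiplicity of $\mu(z)$ is also $m$), and $z\mapsto\pi(z)$ is analytic on $U$ in operator norm. -/

import Mathlib

open Filter Topology

namespace UnboundedOp

variable {H : Type*} [NormedAddCommGroup H] [InnerProductSpace ℂ H]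

/-- The operator `A - lam`, as a linear map from the domain of `A` to `H`. -/
def shift (A : H →ₗ.[ℂ] H) (lam : ℂ) : A.domain →ₗ[ℂ] H :=
  A.toFun - lam • A.domain.subtype

/-- `lam` is in the resolvent set of `A`: the map `A - lam : dom A → H` has an everywhere defined
bounded two-sided inverse. -/
def IsRegularValue (A : H →ₗ.[ℂ] H) (lam : ℂ) : Prop :=
  ∃ R : H →L[ℂ] H,
    (∀ y : H, ∃ f : A.domain, (f : H) = R y ∧ shift A lam f = y) ∧
      ∀ f : A.domain, R (shift A lam f) = f

/-- The spectrum of an (unbounded) operator: the complement of the resolvent set. -/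
def spec (A : H →ₗ.[ℂ] H) : Set ℂ :=
  {lam | ¬ IsRegularValue A lam}

/-- The eigenspace `ker (A - lam)`, as a subspace of `H`. -/
def eigenspace (A : H →ₗ.[ℂ] H) (lam : ℂ) : Submodule ℂ H :=
  (LinearMap.ker (shift A lam)).map A.domain.subtype

/-- `lam` is an eigenvalue of `A` whose eigenspace has finite dimension `m` (and `m ≠ 0`, as `lam`
is an eigenvalue). -/
def IsEigenvalueOfMultiplicity (A : H →ₗ.[ℂ] H) (lam : ℂ) (m : ℕ) : Prop :=
  m ≠ 0 ∧ Module.finrank ℂ (eigenspace A lam) = m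

/-- The spectrum is discrete: it consists of isolated points, each of them an eigenvalue of
finite multiplicity. -/
def HasDiscreteSpectrum (A : H →ₗ.[ℂ] H) : Prop :=
  ∀ lam ∈ spec A,
    (∀ᶠ w in 𝓝[≠] lam, w ∉ spec A) ∧ ∃ m : ℕ, IsEigenvalueOfMultiplicity A lam m

/-- `P` is the eigenprojector of `A` at `lam`: the bounded projection with range `ker (A - lam)`
and with kernel the range of `A - lam`. Such a `P` is unique. If it exists then the eigenvalue
`lam` is semisimple, that is, its algebraic and geometric multiplicities agree; for closed `A`
it is the Riesz spectral projection of `A` at `lam`, and for self-adjoint `A` it is the orthogonal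
projection onto the eigenspace. -/
def IsEigenprojector (A : H →ₗ.[ℂ] H) (lam : ℂ) (P : H →L[ℂ] H) : Prop :=
  P ∘L P = P ∧
    LinearMap.range (P : H →ₗ[ℂ] H) = eigenspace A lam ∧
    LinearMap.ker (P : H →ₗ[ℂ] H) = LinearMap.range (shift A lam)

/-- `T'` is the derivative at `z` of the family `T` of operators with common domain `D`: for
`f ∈ D` and `g ∈ H` the function `w ↦ ⟨T(w) f, g⟩` has derivative `⟨T' f, g⟩` at `z`. (Mathlib's
`inner ℂ g h` is linear in `h` and conjugate-linear in `g`.) -/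
def HasOpDerivAt {D : Submodule ℂ H} (T : ℂ → D →ₗ[ℂ] H) (T' : D →ₗ[ℂ] H) (z : ℂ) : Prop :=
  ∀ (f : D) (g : H), HasDerivAt (fun w => inner ℂ g (T w f)) (inner ℂ g (T' f)) z

end UnboundedOp

/-! For fixed `f` and `g` the entire function ⟨T'(z)f, g⟩ is bounded, hence constant, so T(z) = T(w)
+ (z - w)B with B bounded (`isSymmetricPencil_of_bounded_deriv`). What remains is perturbation
theory for a linear pencil that is self-adjoint with discrete spectrum on the real axis.

Local part (`exists_isEigenSplittingAt`). Let λ₀ be in the spectrum of T(x₀), x₀ real. A scaled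
resolvent S(z) = c(T(z) - ζ)⁻¹, with ζ real and close to λ₀, sends λ₀ to 1 and the rest of the
spectrum of T(x₀) close to 0. So S(x₀) is nearly its own spectral projection at 1, and iterating q ↦
3q² - 2q³ from S(z) gives an analytic finite rank projection P(z), with no contour integral. On its
range S(z) is diagonalized analytically (`exists_isDiagonalizationAt`): remove a scalar part, divide
by a power of z - x₀, and split along an eigenvalue of the self-adjoint leading coefficient; both
pieces have smaller rank. Hence the eigenvalues near λ₀ are finitely many analytic functions with
analytic projections, distinct off x₀.

Global part. Along a branch on an interval the eigenvalue has derivative at most ‖B‖, so it has a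
finite limit at an end point. There the local picture applies, and the identity theorem identifies
the branch with a local one, which carries it further. So every branch lives on all of ℝ
(`exists_isRealBranchAt_global`). Its projection can fail to be a full eigenprojector only where
another branch meets it, on a closed discrete set; constant multiplicity excludes this on (a, b).
The set U is a union of discs centred on ℝ with these exceptional points removed. -/

section Idempotents

/-! ### Analytic families of idempotents by iteration -/

theorem IsIdempotentElem.eq_zero_of_norm_lt_one {A : Type*} [NormedRing A] {e : A}
    (he : e * e = e) (h : ‖e‖ < 1) : e = 0 := by
  by_contra hne
  have h0 : 0 < ‖e‖ := norm_pos_iff.2 hne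
  have h1 : ‖e‖ ≤ ‖e‖ * ‖e‖ := by
    conv_lhs => rw [← he]
    exact norm_mul_le _ _
  nlinarith

/-- For commuting idempotents (p - q)³ = p - q, so (p - q)² is an idempotent of norm below one and
vanishes. -/
theorem eq_of_idempotent_of_commute_of_norm_sub_lt_one {A : Type*} [NormedRing A] {p q : A}
    (hp : p * p = p) (hq : q * q = q) (hc : Commute p q) (h : ‖p - q‖ < 1) : p = q := by
  have hpq : p * q = q * p := hc
  have e1 : (p - p * q) * (p - p * q) = p - p * q := by
    have : p * q * (p * q) = p * q := by
      rw [mul_assoc, ← mul_assoc q, ← hpq, mul_assoc, hq, ← mul_assoc, hp]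
    have h2 : p * (p * q) = p * q := by rw [← mul_assoc, hp]
    have h3 : p * q * p = p * q := by rw [mul_assoc, ← hpq, ← mul_assoc, hp]
    simp only [sub_mul, mul_sub, this, hp, h2, h3]
    abel
  have e2 : (p - q) * (p - q) * (p - q) = p - q := by
    have h3 : p * q * p = p * q := by rw [mul_assoc, ← hpq, ← mul_assoc, hp]
    have h4 : p * q * q = p * q := by rw [mul_assoc, hq]
    simp only [sub_mul, mul_sub, hp, hq, ← hpq, h3, h4]
    abel
  have e3 : ((p - q) * (p - q)) * ((p - q) * (p - q)) = (p - q) * (p - q) := by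
    rw [← mul_assoc, e2]
  have hlt : ‖(p - q) * (p - q)‖ < 1 := by
    refine (norm_mul_le _ _).trans_lt ?_
    nlinarith [norm_nonneg (p - q)]
  have := IsIdempotentElem.eq_zero_of_norm_lt_one e3 hlt
  rw [this, zero_mul] at e2
  exact sub_eq_zero.1 e2.symm

variable {A : Type*} [NormedRing A]

/-- The iteration `q ↦ 3 q² - 2 q³`, which improves an approximate idempotent. -/
def idempotentIter (q : A) : ℕ → A
  | 0 => q
  | n + 1 => idempotentIter q n +
      ((idempotentIter q n * idempotentIter q n - idempotentIter q n) -
        2 * (idempotentIter q n *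
          (idempotentIter q n * idempotentIter q n - idempotentIter q n)))

/-- The new defect is quadratic in the old one; this drives the convergence. -/
theorem idempotentIter_defect (x : A) :
    (x + ((x * x - x) - 2 * (x * (x * x - x)))) * (x + ((x * x - x) - 2 * (x * (x * x - x)))) -
      (x + ((x * x - x) - 2 * (x * (x * x - x)))) =
    4 * ((x * x - x) * (x * x - x) * (x * x - x)) - 3 * ((x * x - x) * (x * x - x)) := by
  noncomm_ring

/-- While the iterates have norm at most 3, a step moves by at most (1 + 2·3) = 7 times the defect.
The defect at least halves each time, so the total displacement is at most 14 times the initial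
defect, and 14/32 < 1 keeps the norm below 3. -/
theorem idempotentIter_bounds {q : A} (h2 : ‖q‖ ≤ 2) (hE : ‖q * q - q‖ ≤ 1 / 32) (n : ℕ) :
    ‖idempotentIter q n * idempotentIter q n - idempotentIter q n‖ ≤
        ‖q * q - q‖ * (1 / 2) ^ n ∧
      ‖idempotentIter q n - q‖ ≤ 14 * ‖q * q - q‖ * (1 - (1 / 2) ^ n) ∧
      ‖idempotentIter q (n + 1) - idempotentIter q n‖ ≤ 7 * ‖q * q - q‖ * (1 / 2) ^ n := by
  have step : ∀ n, ‖idempotentIter q n * idempotentIter q n - idempotentIter q n‖ ≤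
        ‖q * q - q‖ * (1 / 2) ^ n → ‖idempotentIter q n - q‖ ≤ 14 * ‖q * q - q‖ *
        (1 - (1 / 2) ^ n) →
      ‖idempotentIter q (n + 1) - idempotentIter q n‖ ≤ 7 * ‖q * q - q‖ * (1 / 2) ^ n := by
    intro n h1 h3
    have hpow : (0 : ℝ) < (1 / 2) ^ n := by positivity
    have hq3 : ‖idempotentIter q n‖ ≤ 3 := by
      have := norm_add_le (idempotentIter q n - q) q
      rw [sub_add_cancel] at this
      nlinarith [norm_nonneg (q * q - q)]
    set x := idempotentIter q n with hx
    have : idempotentIter q (n + 1) - x =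
        (x * x - x) - (x * (x * x - x) + x * (x * x - x)) := by
      rw [idempotentIter, ← hx, two_mul]; abel
    rw [this]
    have hm : ‖x * (x * x - x)‖ ≤ 3 * ‖x * x - x‖ :=
      (norm_mul_le _ _).trans (mul_le_mul_of_nonneg_right hq3 (norm_nonneg _))
    have := norm_sub_le (x * x - x) (x * (x * x - x) + x * (x * x - x))
    have := norm_add_le (x * (x * x - x)) (x * (x * x - x))
    nlinarith
  have key : ‖idempotentIter q n * idempotentIter q n - idempotentIter q n‖ ≤
        ‖q * q - q‖ * (1 / 2) ^ n ∧
      ‖idempotentIter q n - q‖ ≤ 14 * ‖q * q - q‖ * (1 - (1 / 2) ^ n) := by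
    induction n with
    | zero => simp [idempotentIter]
    | succ n ih =>
      obtain ⟨h1, h3⟩ := ih
      have h4 := step n h1 h3
      have hpow : (0 : ℝ) < (1 / 2) ^ n := by positivity
      have hpow1 : ((1 : ℝ) / 2) ^ n ≤ 1 := pow_le_one₀ (by norm_num) (by norm_num)
      constructor
      · set x := idempotentIter q n with hx
        have : idempotentIter q (n + 1) * idempotentIter q (n + 1) - idempotentIter q (n + 1) =
            4 * ((x * x - x) * (x * x - x) * (x * x - x)) - 3 * ((x * x - x) * (x * x - x)) := by
          rw [← idempotentIter_defect]; rfl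
        rw [this]
        set E := x * x - x with hEdef
        have hE8 : ‖E‖ ≤ 1 / 8 := by nlinarith [norm_nonneg (q * q - q)]
        have a1 : ‖E * E‖ ≤ ‖E‖ * ‖E‖ := norm_mul_le _ _
        have a2 : ‖E * E * E‖ ≤ ‖E‖ * ‖E‖ * ‖E‖ :=
          (norm_mul_le _ _).trans (mul_le_mul_of_nonneg_right a1 (norm_nonneg _))
        have a3 : ‖4 * (E * E * E)‖ ≤ 4 * ‖E * E * E‖ := by
          have : (4 : A) * (E * E * E) = 4 • (E * E * E) := by rw [nsmul_eq_mul]; norm_num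
          rw [this]
          simpa using norm_nsmul_le (n := 4) (a := E * E * E)
        have a4 : ‖3 * (E * E)‖ ≤ 3 * ‖E * E‖ := by
          have : (3 : A) * (E * E) = 3 • (E * E) := by rw [nsmul_eq_mul]; norm_num
          rw [this]
          simpa using norm_nsmul_le (n := 3) (a := E * E)
        have a5 := norm_sub_le (4 * (E * E * E)) (3 * (E * E))
        have a6 : ‖E‖ * ‖E‖ ≤ ‖E‖ * (1 / 8) := mul_le_mul_of_nonneg_left hE8 (norm_nonneg _)
        have a7 : ‖E‖ * ‖E‖ * ‖E‖ ≤ ‖E‖ * (1 / 8) * (1 / 8) :=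
          mul_le_mul a6 hE8 (norm_nonneg _) (by positivity)
        rw [pow_succ]
        nlinarith [norm_nonneg E]
      · have := norm_add_le (idempotentIter q (n + 1) - idempotentIter q n)
          (idempotentIter q n - q)
        rw [sub_add_sub_cancel] at this
        rw [pow_succ]
        nlinarith
  exact ⟨key.1, key.2, step n key.1 key.2⟩

/-- The limit of the iteration `q ↦ 3 q² - 2 q³`: an idempotent close to `q`. -/
noncomputable def idempotentLimit (q : A) : A :=
  q + ∑' n, (idempotentIter q (n + 1) - idempotentIter q n)

variable [CompleteSpace A]

theorem summable_idempotentIter_bound (c : ℝ) : Summable fun n : ℕ => 7 * c * (1 / 2) ^ n :=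
  (summable_geometric_of_lt_one (by norm_num) (by norm_num)).mul_left _

theorem tendsto_idempotentIter {q : A} (h2 : ‖q‖ ≤ 2) (hE : ‖q * q - q‖ ≤ 1 / 32) :
    Tendsto (idempotentIter q) atTop (𝓝 (idempotentLimit q)) := by
  have hs : Summable fun n => (idempotentIter q (n + 1) - idempotentIter q n) :=
    Summable.of_norm_bounded (summable_idempotentIter_bound ‖q * q - q‖)
      fun n => (idempotentIter_bounds h2 hE n).2.2
  have := hs.hasSum.tendsto_sum_nat.const_add q
  refine this.congr fun n => ?_
  rw [Finset.sum_range_sub]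
  simp [idempotentIter]

theorem idempotentLimit_mul_self {q : A} (h2 : ‖q‖ ≤ 2) (hE : ‖q * q - q‖ ≤ 1 / 32) :
    idempotentLimit q * idempotentLimit q = idempotentLimit q := by
  have ht := tendsto_idempotentIter h2 hE
  have h1 := (ht.mul ht).sub ht
  have h0 : Tendsto (fun n => idempotentIter q n * idempotentIter q n - idempotentIter q n)
      atTop (𝓝 0) := by
    refine squeeze_zero_norm (fun n => (idempotentIter_bounds h2 hE n).1) ?_
    simpa using (tendsto_pow_atTop_nhds_zero_of_lt_one (r := (1 / 2 : ℝ)) (by norm_num)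
      (by norm_num)).const_mul ‖q * q - q‖
  exact sub_eq_zero.1 (tendsto_nhds_unique h1 h0)

theorem norm_idempotentLimit_sub_le {q : A} (h2 : ‖q‖ ≤ 2) (hE : ‖q * q - q‖ ≤ 1 / 32) :
    ‖idempotentLimit q - q‖ ≤ 14 * ‖q * q - q‖ := by
  refine le_of_tendsto ((tendsto_idempotentIter h2 hE).sub_const q).norm
    (Eventually.of_forall fun n => (idempotentIter_bounds h2 hE n).2.1.trans ?_)
  have hpow : (0 : ℝ) < (1 / 2) ^ n := by positivity
  nlinarith [norm_nonneg (q * q - q)]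

omit [CompleteSpace A] in
theorem Commute.idempotentIter {q y : A} (h : Commute q y) (n : ℕ) :
    Commute (idempotentIter q n) y := by
  induction n with
  | zero => exact h
  | succ n ih =>
    have hE := (ih.mul_left ih).sub_left ih
    exact ih.add_left (hE.sub_left
      (Commute.mul_left (Nat.cast_commute 2 y) (ih.mul_left hE)))

theorem Commute.idempotentLimit {q y : A} (h2 : ‖q‖ ≤ 2) (hE : ‖q * q - q‖ ≤ 1 / 32)
    (h : Commute q y) : Commute (idempotentLimit q) y := by
  have ht := tendsto_idempotentIter h2 hE
  exact tendsto_nhds_unique (ht.mul_const y)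
    ((ht.const_mul y).congr fun n => (h.idempotentIter n).symm)

omit [CompleteSpace A] in
theorem IsSelfAdjoint.idempotentIter [StarRing A] {q : A} (h : IsSelfAdjoint q) (n : ℕ) :
    IsSelfAdjoint (idempotentIter q n) := by
  induction n with
  | zero => exact h
  | succ n ih =>
    set x := _root_.idempotentIter q n with hx
    have : _root_.idempotentIter q (n + 1) =
      x + ((x * x - x) - (x * (x * x - x) + x * (x * x - x))) := by
      rw [_root_.idempotentIter, ← hx, two_mul]
    rw [this]
    have h1 : star x = x := ih
    simp only [isSelfAdjoint_iff, star_add, star_sub, star_mul, h1, mul_sub, mul_assoc]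

theorem IsSelfAdjoint.idempotentLimit [StarRing A] [ContinuousStar A] {q : A} (h2 : ‖q‖ ≤ 2)
    (hE : ‖q * q - q‖ ≤ 1 / 32) (h : IsSelfAdjoint q) : IsSelfAdjoint (idempotentLimit q) := by
  have ht := tendsto_idempotentIter h2 hE
  exact tendsto_nhds_unique ((continuous_star.tendsto _).comp ht)
    (ht.congr fun n => (h.idempotentIter n).symm)

/-- An analytic family that is close to an idempotent `p₀` at `z₀` gives an analytic family of
idempotents through `p₀`. -/
theorem exists_analyticAt_idempotent [NormedAlgebra ℂ A] [StarRing A] [ContinuousStar A]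
    {Q : ℂ → A} {z₀ : ℂ} (hQ : AnalyticAt ℂ Q z₀) {p₀ : A} (hp₀ : p₀ * p₀ = p₀)
    (hp₀n : ‖p₀‖ ≤ 1) (hc : Commute (Q z₀) p₀) (hd : ‖Q z₀ - p₀‖ ≤ 1 / 100) :
    ∃ P : ℂ → A, AnalyticAt ℂ P z₀ ∧ P z₀ = p₀ ∧ ∀ᶠ z in 𝓝 z₀,
      P z * P z = P z ∧ (∀ y, Commute (Q z) y → Commute (P z) y) ∧
        (IsSelfAdjoint (Q z) → IsSelfAdjoint (P z)) := by
  have hE0 : ‖Q z₀ * Q z₀ - Q z₀‖ ≤ 301 / 10000 := by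
    set δ := Q z₀ - p₀ with hδ
    have hq : Q z₀ = p₀ + δ := by simp [hδ]
    have : Q z₀ * Q z₀ - Q z₀ = p₀ * δ + δ * p₀ + δ * δ - δ := by
      rw [hq]; simp only [add_mul, mul_add, hp₀]; abel
    rw [this]
    have a1 := norm_sub_le (p₀ * δ + δ * p₀ + δ * δ) δ
    have a2 := norm_add_le (p₀ * δ + δ * p₀) (δ * δ)
    have a3 := norm_add_le (p₀ * δ) (δ * p₀)
    have a4 := norm_mul_le p₀ δ
    have a5 := norm_mul_le δ p₀
    have a6 := norm_mul_le δ δ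
    nlinarith [norm_nonneg δ, norm_nonneg p₀]
  have h20 : ‖Q z₀‖ ≤ 101 / 100 := by
    have := norm_add_le (Q z₀ - p₀) p₀
    rw [sub_add_cancel] at this
    linarith
  have hEc : ContinuousAt (fun z => ‖Q z * Q z - Q z‖) z₀ :=
    ((hQ.continuousAt.mul hQ.continuousAt).sub hQ.continuousAt).norm
  have e1 : ∀ᶠ z in 𝓝 z₀, ‖Q z * Q z - Q z‖ < 1 / 32 :=
    hEc.eventually_lt continuousAt_const (by linarith)
  have e2 : ∀ᶠ z in 𝓝 z₀, ‖Q z‖ < 2 :=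
    hQ.continuousAt.norm.eventually_lt continuousAt_const (by linarith)
  obtain ⟨r, hr, hball⟩ := Metric.eventually_nhds_iff_ball.1
    (e1.and (e2.and hQ.eventually_analyticAt))
  have hQd : DifferentiableOn ℂ Q (Metric.ball z₀ r) := fun z hz =>
    (hball z hz).2.2.differentiableAt.differentiableWithinAt
  have hiter : ∀ n, DifferentiableOn ℂ (fun z => idempotentIter (Q z) n) (Metric.ball z₀ r) := by
    intro n
    induction n with
    | zero => exact hQd
    | succ n ih =>
      have hE := (ih.mul ih).sub ih
      exact ih.add (hE.sub ((differentiableOn_const 2).mul (ih.mul hE)))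
  refine ⟨fun z => idempotentLimit (Q z), ?_, ?_, ?_⟩
  -- Each increment is a polynomial in `Q z`, and the geometric bound is uniform on the ball, so the
  -- sum of the series is analytic.
  · have : DifferentiableOn ℂ (fun z => idempotentLimit (Q z)) (Metric.ball z₀ r) := by
      refine hQd.add (Complex.differentiableOn_tsum_of_summable_norm
        (summable_idempotentIter_bound (1 / 32)) (fun n => (hiter (n + 1)).sub (hiter n))
        Metric.isOpen_ball fun n z hz => ?_)
      obtain ⟨b1, b2, -⟩ := hball z hz
      refine (idempotentIter_bounds b2.le b1.le n).2.2.trans ?_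
      gcongr
    exact this.analyticAt (Metric.ball_mem_nhds _ hr)
  · have b1 : ‖Q z₀ * Q z₀ - Q z₀‖ ≤ 1 / 32 := by linarith
    have b2 : ‖Q z₀‖ ≤ 2 := by linarith
    -- Both are idempotents, they commute, and their distance is at most 14 · 0.0301 + 0.01 < 1.
    refine eq_of_idempotent_of_commute_of_norm_sub_lt_one (idempotentLimit_mul_self b2 b1) hp₀
      (Commute.idempotentLimit b2 b1 hc) ?_
    have a1 := norm_idempotentLimit_sub_le b2 b1
    have a2 := norm_add_le (idempotentLimit (Q z₀) - Q z₀) (Q z₀ - p₀)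
    rw [sub_add_sub_cancel] at a2
    linarith
  · filter_upwards [e1, e2] with z b1 b2
    exact ⟨idempotentLimit_mul_self b2.le b1.le, fun y hy => Commute.idempotentLimit b2.le b1.le hy,
      fun h => IsSelfAdjoint.idempotentLimit b2.le b1.le h⟩

end Idempotents

/-! ### Splitting a projection along an eigenvalue -/

section Splitting

open Polynomial

theorem IsSelfAdjoint.aeval_real {A : Type*} [CStarAlgebra A] {a : A} (ha : IsSelfAdjoint a)
    (f : ℝ[X]) : IsSelfAdjoint (aeval a f) := by
  rw [← cfc_polynomial f a ha]
  exact IsSelfAdjoint.cfc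

/-- A nonzero self-adjoint element with finite spectrum has a nonzero spectral projection which is
a polynomial without constant term. -/
theorem IsSelfAdjoint.exists_spectral_polynomial {A : Type*} [CStarAlgebra A] {a : A}
    (ha : IsSelfAdjoint a) (h0 : a ≠ 0) (hfin : (spectrum ℝ a).Finite) :
    ∃ (f : ℝ[X]) (κ : ℝ), κ ≠ 0 ∧ f.eval 0 = 0 ∧ f.eval κ = 1 ∧ aeval a f ≠ 0 ∧
      aeval a f * aeval a f = aeval a f ∧ a * aeval a f = κ • aeval a f := by
  obtain ⟨κ, hκs, hκ⟩ : ∃ κ ∈ spectrum ℝ a, κ ≠ 0 := by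
    by_contra! h
    refine h0 ?_
    rw [← cfc_id ℝ a ha, cfc_congr (f := id) (g := fun _ => (0 : ℝ)) (fun x hx => h x hx)]
    exact cfc_zero ℝ a
  classical
  -- The polynomial interpolates the indicator of κ on the spectrum. The node 0 is added so that it
  -- has no constant term even when 0 is not in the spectrum.
  set s : Finset ℝ := insert 0 hfin.toFinset with hs
  set f : ℝ[X] := Lagrange.interpolate s id (fun x => if x = κ then 1 else 0) with hf
  have hev : ∀ x ∈ s, f.eval x = if x = κ then 1 else 0 := fun x hx =>
    Lagrange.eval_interpolate_at_node (v := id) (i := x) _ (Function.injective_id.injOn) hx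
  have hevs : ∀ x ∈ spectrum ℝ a, f.eval x = if x = κ then 1 else 0 := fun x hx =>
    hev x (by simp [hs, hx])
  have hmul : ∀ g : ℝ[X], aeval a g = cfc (fun x => g.eval x) a := fun g =>
    (cfc_polynomial g a ha).symm
  have hfκ : f.eval κ = 1 := by rw [hevs κ hκs, if_pos rfl]
  refine ⟨f, κ, hκ, ?_, hfκ, ?_, ?_, ?_⟩
  · rw [hev 0 (by simp [hs]), if_neg (Ne.symm hκ)]
  · intro h
    rw [hmul] at h
    have : ‖f.eval κ‖ ≤ ‖cfc (fun x => f.eval x) a‖ :=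
      norm_apply_le_norm_cfc (fun x => f.eval x) a hκs f.continuous.continuousOn ha
    rw [h, hfκ] at this
    norm_num at this
  · rw [← map_mul, hmul, hmul]
    refine cfc_congr fun x hx => ?_
    simp only [eval_mul, hevs x hx]
    split_ifs <;> simp
  · have e1 : a * aeval a f = aeval a (X * f) := by simp
    have e2 : κ • aeval a f = aeval a (C κ * f) := by simp [Algebra.smul_def]
    rw [e1, e2, hmul, hmul]
    refine cfc_congr fun x hx => ?_
    simp only [eval_mul, hevs x hx, eval_X, eval_C]
    split_ifs with h <;> simp [h]

theorem aeval_mul_of_mul_eq_smul {A : Type*} [Ring A] [Algebra ℝ A] {a e : A} {κ : ℝ}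
    (h : a * e = κ • e) (f : ℝ[X]) : aeval a f * e = f.eval κ • e := by
  induction f using Polynomial.induction_on' with
  | add p q hp hq => simp [add_mul, hp, hq, add_smul]
  | monomial n c =>
    have : ∀ n : ℕ, a ^ n * e = κ ^ n • e := by
      intro n
      induction n with
      | zero => simp
      | succ n ih => rw [pow_succ, mul_assoc, h, mul_smul_comm, ih, smul_smul, pow_succ', mul_comm]
    rw [aeval_monomial, eval_monomial, mul_assoc, this, ← Algebra.smul_def, smul_smul]

theorem aeval_mul_eq_self {A : Type*} [Ring A] [Algebra ℝ A] {a p : A} (h : a * p = a)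
    {f : ℝ[X]} (hf : f.eval 0 = 0) : aeval a f * p = aeval a f := by
  obtain ⟨g, rfl⟩ : X ∣ f := by rw [X_dvd_iff, ← hf, coeff_zero_eq_eval_zero]
  rw [mul_comm, map_mul, aeval_X, mul_assoc, h]

theorem mul_aeval_eq_self {A : Type*} [Ring A] [Algebra ℝ A] {a p : A} (h : p * a = a)
    {f : ℝ[X]} (hf : f.eval 0 = 0) : p * aeval a f = aeval a f := by
  obtain ⟨g, rfl⟩ : X ∣ f := by rw [X_dvd_iff, ← hf, coeff_zero_eq_eval_zero]
  rw [map_mul, aeval_X, ← mul_assoc, h]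

theorem AnalyticAt.aeval_real {A : Type*} [NormedRing A] [NormedAlgebra ℂ A] {N : ℂ → A} {z₀ : ℂ}
    (hN : AnalyticAt ℂ N z₀) (f : ℝ[X]) : AnalyticAt ℂ (fun z => aeval (N z) f) z₀ := by
  have : (fun z => aeval (N z) f) = fun z => aeval (N z) (f.map (algebraMap ℝ ℂ)) := by
    ext z; rw [aeval_map_algebraMap]
  rw [this]
  exact hN.aeval_polynomial (f.map (algebraMap ℝ ℂ))

theorem norm_le_one_of_isSelfAdjoint_idempotent {A : Type*} [CStarAlgebra A] {p : A}
    (hs : IsSelfAdjoint p) (hp : p * p = p) : ‖p‖ ≤ 1 := by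
  have h := CStarRing.norm_star_mul_self (x := p)
  rw [hs.star_eq, hp] at h
  by_contra! h1
  nlinarith

/-- Analytic splitting of a family of projections along a spectral projection of the reduced
family `N` at `x₀`. -/
theorem exists_analytic_subprojection {A : Type*} [CStarAlgebra A] {N P : ℂ → A} {x₀ : ℝ}
    (hN : AnalyticAt ℂ N x₀) (hP : AnalyticAt ℂ P x₀)
    (hPi : ∀ᶠ z in 𝓝 (x₀ : ℂ), P z * P z = P z)
    (hNP : ∀ᶠ z in 𝓝 (x₀ : ℂ), N z * P z = N z)
    (hPN : ∀ᶠ z in 𝓝 (x₀ : ℂ), P z * N z = N z)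
    (hNs : ∀ᶠ x : ℝ in 𝓝 x₀, IsSelfAdjoint (N x))
    (hN0 : N x₀ ≠ 0) (hfin : (spectrum ℝ (N x₀)).Finite) :
    ∃ (P' : ℂ → A) (κ : ℝ), κ ≠ 0 ∧ AnalyticAt ℂ P' x₀ ∧
      (∀ᶠ z in 𝓝 (x₀ : ℂ), P' z * P' z = P' z ∧ Commute (P' z) (N z) ∧ P' z * P z = P' z ∧
        P z * P' z = P' z) ∧
      (∀ᶠ x : ℝ in 𝓝 x₀, IsSelfAdjoint (P' x)) ∧
      P' x₀ ≠ 0 ∧ N x₀ * P' x₀ = κ • P' x₀ ∧ ∀ e, N x₀ * e = κ • e → P' x₀ * e = e := by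
  have hs0 : IsSelfAdjoint (N x₀) := hNs.self_of_nhds
  obtain ⟨f, κ, hκ, hf0, hfκ, hne, hidem, hmul⟩ := hs0.exists_spectral_polynomial hN0 hfin
  obtain ⟨P', hP'a, hP'0, hP'⟩ := exists_analyticAt_idempotent (hN.aeval_real f) hidem
    (norm_le_one_of_isSelfAdjoint_idempotent (hs0.aeval_real f) hidem) (Commute.refl _)
    (by simp)
  refine ⟨P', κ, hκ, hP'a, ?_, ?_, by rwa [hP'0], by rwa [hP'0], fun e he => ?_⟩
  -- `P' - P' P` is an idempotent near `x₀` that vanishes at `x₀`, so by continuity it is zero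
  -- nearby: `P'` stays below `P`.
  · have hsmall : ∀ᶠ z in 𝓝 (x₀ : ℂ), ‖P' z - P' z * P z‖ < 1 := by
      refine ((hP'a.continuousAt.sub (hP'a.continuousAt.mul hP.continuousAt)).norm).eventually_lt
        continuousAt_const ?_
      rw [Pi.sub_apply, Pi.mul_apply, hP'0, aeval_mul_eq_self hNP.self_of_nhds hf0]
      simp
    filter_upwards [hP', hsmall, hPi, hNP, hPN] with z ⟨h1, h2, _⟩ h3 h4 h5 h6
    have hcP : Commute (P' z) (P z) := h2 _ (by
      rw [commute_iff_eq, aeval_mul_eq_self h5 hf0, mul_aeval_eq_self h6 hf0])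
    have hcP' : P' z * P z = P z * P' z := hcP
    have hz : P' z - P' z * P z = 0 := by
      refine IsIdempotentElem.eq_zero_of_norm_lt_one ?_ h3
      have e2 : P' z * P z * P' z = P' z * P z := by rw [mul_assoc, ← hcP', ← mul_assoc, h1]
      have e3 : P' z * P z * (P' z * P z) = P' z * P z := by rw [← mul_assoc, e2, mul_assoc, h4]
      have e4 : P' z * (P' z * P z) = P' z * P z := by rw [← mul_assoc, h1]
      simp only [mul_sub, sub_mul, h1, e2, e3, e4]
      abel
    have e1 : P' z * P z = P' z := (sub_eq_zero.1 hz).symm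
    have hcN : Commute (aeval (N z) f) (N z) := by
      simpa using (Commute.all f X).map (aeval (R := ℝ) (N z))
    exact ⟨h1, h2 _ hcN, e1, hcP' ▸ e1⟩
  · filter_upwards [hNs, Complex.continuous_ofReal.continuousAt.eventually hP'] with x h1 h2
    exact h2.2.2 (h1.aeval_real f)
  · rw [hP'0, aeval_mul_of_mul_eq_smul he, hfκ, one_smul]

end Splitting

/-! ### Combining analytic diagonalizations -/

section Diagonalization

variable {A : Type*} [NormedRing A] [NormedAlgebra ℂ A] {ι κ : Type} [Fintype ι] [Fintype κ]

/-- Near `z₀` the idempotents `p j z` are an orthogonal decomposition of `P z` into analytic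
families, and `M z` acts on `p j z` as the scalar `s j z`; the `s j z` are distinct for `z ≠ z₀`. -/
structure IsDiagonalizationAt (M P : ℂ → A) (z₀ : ℂ) (s : ι → ℂ → ℂ) (p : ι → ℂ → A) : Prop where
  analyticAt_s : ∀ j, AnalyticAt ℂ (s j) z₀
  analyticAt_p : ∀ j, AnalyticAt ℂ (p j) z₀
  ne_zero : ∀ j, p j z₀ ≠ 0
  idem : ∀ᶠ z in 𝓝 z₀, ∀ j, p j z * p j z = p j z
  orth : ∀ᶠ z in 𝓝 z₀, ∀ i j, i ≠ j → p i z * p j z = 0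
  sum : ∀ᶠ z in 𝓝 z₀, ∑ j, p j z = P z
  left : ∀ᶠ z in 𝓝 z₀, ∀ j, M z * p j z = s j z • p j z
  right : ∀ᶠ z in 𝓝 z₀, ∀ j, p j z * M z = s j z • p j z
  distinct : ∀ᶠ z in 𝓝[≠] z₀, ∀ i j, i ≠ j → s i z ≠ s j z

theorem sum_mul_orthogonal {R : Type*} [Ring R] {p : ι → R}
    (hi : ∀ j, p j * p j = p j) (ho : ∀ i j, i ≠ j → p i * p j = 0) (j : ι) :
    (∑ i, p i) * p j = p j ∧ p j * (∑ i, p i) = p j := by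
  classical
  constructor
  · rw [Finset.sum_mul, Finset.sum_eq_single j (fun i _ h => ho i j h) (by simp), hi]
  · rw [Finset.mul_sum, Finset.sum_eq_single j (fun i _ h => ho j i h.symm) (by simp), hi]

namespace IsDiagonalizationAt

theorem mul_p {M P : ℂ → A} {z₀ : ℂ} {s : ι → ℂ → ℂ} {p : ι → ℂ → A}
    (h : IsDiagonalizationAt M P z₀ s p) :
    ∀ᶠ z in 𝓝 z₀, ∀ j, P z * p j z = p j z ∧ p j z * P z = p j z := by
  filter_upwards [h.idem, h.orth, h.sum] with z h1 h2 h3 j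
  rw [← h3]
  exact sum_mul_orthogonal h1 h2 j

/-- Undoes one reduction step: on the range of `P`, `M` is `τ + (z - z₀)^k N`, so projections are
kept and eigenvalues transform affinely. The factor `(z - z₀)^k` is nonzero off `z₀`, which
preserves distinctness. -/
theorem ofAffine {M N P : ℂ → A} {z₀ : ℂ} {s : ι → ℂ → ℂ} {p : ι → ℂ → A} {τ : ℂ → ℂ} {k : ℕ}
    (h : IsDiagonalizationAt N P z₀ s p) (hτ : AnalyticAt ℂ τ z₀)
    (hc : ∀ᶠ z in 𝓝 z₀, Commute (P z) (M z))
    (hM : ∀ᶠ z in 𝓝 z₀, M z * P z - τ z • P z = (z - z₀) ^ k • N z) :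
    IsDiagonalizationAt M P z₀ (fun j z => τ z + (z - z₀) ^ k * s j z) p where
  analyticAt_s j := hτ.add (((analyticAt_id.sub analyticAt_const).pow k).mul (h.analyticAt_s j))
  analyticAt_p := h.analyticAt_p
  ne_zero := h.ne_zero
  idem := h.idem
  orth := h.orth
  sum := h.sum
  left := by
    filter_upwards [h.left, h.mul_p, hM] with z h1 h2 h3 j
    have : M z * p j z = (M z * P z) * p j z := by rw [mul_assoc, (h2 j).1]
    rw [this, sub_eq_iff_eq_add.1 h3, add_mul, smul_mul_assoc, smul_mul_assoc, h1, (h2 j).1,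
      add_smul, mul_smul, add_comm]
  right := by
    filter_upwards [h.right, h.mul_p, hM, hc] with z h1 h2 h3 h4 j
    have : p j z * M z = p j z * (M z * P z) := by rw [← h4.eq, ← mul_assoc, (h2 j).2]
    rw [this, sub_eq_iff_eq_add.1 h3, mul_add, mul_smul_comm, mul_smul_comm, h1, (h2 j).2,
      add_smul, mul_smul, add_comm]
  distinct := by
    filter_upwards [h.distinct, self_mem_nhdsWithin] with z h1 h2 i j hij he
    refine h1 i j hij ?_
    exact mul_left_cancel₀ (pow_ne_zero k (sub_ne_zero.2 h2)) (add_left_cancel he)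

theorem sumElim {M P Q : ℂ → A} {z₀ : ℂ} {s : ι → ℂ → ℂ} {p : ι → ℂ → A} {t : κ → ℂ → ℂ}
    {q : κ → ℂ → A} (h : IsDiagonalizationAt M P z₀ s p) (h' : IsDiagonalizationAt M Q z₀ t q)
    (hPQ : ∀ᶠ z in 𝓝 z₀, P z * Q z = 0 ∧ Q z * P z = 0) (hne : ∀ i j, s i z₀ ≠ t j z₀) :
    IsDiagonalizationAt M (fun z => P z + Q z) z₀ (Sum.elim s t) (Sum.elim p q) where
  analyticAt_s := by rintro (j | j); exacts [h.analyticAt_s j, h'.analyticAt_s j]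
  analyticAt_p := by rintro (j | j); exacts [h.analyticAt_p j, h'.analyticAt_p j]
  ne_zero := by rintro (j | j); exacts [h.ne_zero j, h'.ne_zero j]
  idem := by
    filter_upwards [h.idem, h'.idem] with z h1 h2
    rintro (j | j); exacts [h1 j, h2 j]
  orth := by
    filter_upwards [h.orth, h'.orth, h.mul_p, h'.mul_p, hPQ] with z h1 h2 h3 h4 h5
    rintro (i | i) (j | j) hij
    · exact h1 i j (fun h => hij (by rw [h]))
    · change p i z * q j z = 0
      rw [← (h3 i).2, ← (h4 j).1, mul_assoc, ← mul_assoc (P z), h5.1, zero_mul, mul_zero]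
    · change q i z * p j z = 0
      rw [← (h4 i).2, ← (h3 j).1, mul_assoc, ← mul_assoc (Q z), h5.2, zero_mul, mul_zero]
    · exact h2 i j (fun h => hij (by rw [h]))
  sum := by
    filter_upwards [h.sum, h'.sum] with z h1 h2
    rw [Fintype.sum_sum_type, ← h1, ← h2]; rfl
  left := by
    filter_upwards [h.left, h'.left] with z h1 h2
    rintro (j | j); exacts [h1 j, h2 j]
  right := by
    filter_upwards [h.right, h'.right] with z h1 h2
    rintro (j | j); exacts [h1 j, h2 j]
  distinct := by
    have hst : ∀ᶠ z in 𝓝 z₀, ∀ i j, s i z ≠ t j z := by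
      rw [eventually_all]; intro i
      rw [eventually_all]; intro j
      exact ((h.analyticAt_s i).continuousAt.ne_iff_eventually_ne
        (h'.analyticAt_s j).continuousAt).1 (hne i j)
    filter_upwards [h.distinct, h'.distinct, hst.filter_mono nhdsWithin_le_nhds] with z h1 h2 h3
    rintro (i | i) (j | j) hij
    · exact h1 i j (fun h => hij (by rw [h]))
    · exact h3 i j
    · exact (h3 j i).symm
    · exact h2 i j (fun h => hij (by rw [h]))

end IsDiagonalizationAt

end Diagonalization

/-! ### Ranks of idempotents and operators of finite rank -/

section FiniteRank

open Polynomial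

variable {H : Type*} [NormedAddCommGroup H] [InnerProductSpace ℂ H]

theorem apply_eq_self_of_mem_range {p : H →L[ℂ] H} (hp : p * p = p) {x : H}
    (hx : x ∈ LinearMap.range (p : H →ₗ[ℂ] H)) : p x = x := by
  obtain ⟨y, rfl⟩ := hx
  exact congrArg (fun q : H →L[ℂ] H => q y) hp

/-- Idempotents at distance less than one have isomorphic ranges. -/
theorem finrank_range_eq_of_norm_sub_lt_one {p q : H →L[ℂ] H} (hp : p * p = p) (hq : q * q = q)
    (h : ‖p - q‖ < 1) [FiniteDimensional ℂ (LinearMap.range (p : H →ₗ[ℂ] H))] :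
    FiniteDimensional ℂ (LinearMap.range (q : H →ₗ[ℂ] H)) ∧
    Module.finrank ℂ (LinearMap.range (q : H →ₗ[ℂ] H)) =
      Module.finrank ℂ (LinearMap.range (p : H →ₗ[ℂ] H)) := by
  have key : ∀ {p q : H →L[ℂ] H}, p * p = p → ‖p - q‖ < 1 → Function.Injective
      ((q : H →ₗ[ℂ] H).restrict (p := LinearMap.range (p : H →ₗ[ℂ] H))
        (q := LinearMap.range (q : H →ₗ[ℂ] H)) (fun x _ => ⟨x, rfl⟩)) := by
    intro p q hp h
    rw [← LinearMap.ker_eq_bot, LinearMap.ker_eq_bot']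
    rintro ⟨x, hx⟩ h0
    have hqx : q x = 0 := congrArg Subtype.val h0
    have hpx := apply_eq_self_of_mem_range hp hx
    have h1 : ‖x‖ ≤ ‖p - q‖ * ‖x‖ := by
      have := (p - q).le_opNorm x
      rwa [sub_apply, hpx, hqx, sub_zero] at this
    have : ‖x‖ = 0 := by nlinarith [norm_nonneg x]
    exact Subtype.ext (norm_eq_zero.1 this)
  have hfin : FiniteDimensional ℂ (LinearMap.range (q : H →ₗ[ℂ] H)) :=
    Module.Finite.of_injective _ (key (p := q) (q := p) hq (by rwa [norm_sub_rev]))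
  exact ⟨hfin, le_antisymm
    (LinearMap.finrank_le_finrank_of_injective
      (key (p := q) (q := p) hq (by rwa [norm_sub_rev])))
    (LinearMap.finrank_le_finrank_of_injective (key hp h))⟩

theorem finrank_range_lt_of_ne {p q : H →L[ℂ] H} (hq : q * q = q)
    (hpq : p * q = q) (hqp : q * p = q) (hne : q ≠ p)
    [FiniteDimensional ℂ (LinearMap.range (p : H →ₗ[ℂ] H))] :
    FiniteDimensional ℂ (LinearMap.range (q : H →ₗ[ℂ] H)) ∧
    Module.finrank ℂ (LinearMap.range (q : H →ₗ[ℂ] H)) <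
      Module.finrank ℂ (LinearMap.range (p : H →ₗ[ℂ] H)) := by
  have hle : LinearMap.range (q : H →ₗ[ℂ] H) ≤ LinearMap.range (p : H →ₗ[ℂ] H) := by
    rintro _ ⟨x, rfl⟩
    exact ⟨q x, congrArg (fun r : H →L[ℂ] H => r x) hpq⟩
  refine ⟨Submodule.finiteDimensional_of_le hle, Submodule.finrank_lt_finrank_of_lt
    (lt_of_le_of_ne hle fun he => hne ?_)⟩
  ext x
  have hx : p x ∈ LinearMap.range (q : H →ₗ[ℂ] H) := he ▸ ⟨x, rfl⟩
  rw [← apply_eq_self_of_mem_range hq hx]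
  exact (congrArg (fun r : H →L[ℂ] H => r x) hqp).symm

/-- An operator with range in a finite dimensional space has finite spectrum. -/
theorem finite_spectrum_of_mul_eq {N P : H →L[ℂ] H} (h : P * N = N)
    [FiniteDimensional ℂ (LinearMap.range (P : H →ₗ[ℂ] H))] : (spectrum ℝ N).Finite := by
  set V := LinearMap.range (P : H →ₗ[ℂ] H) with hV
  have hNV : ∀ x, N x ∈ V := fun x => ⟨N x, congrArg (fun r : H →L[ℂ] H => r x) h⟩
  set n : V →ₗ[ℂ] V := (N : H →ₗ[ℂ] H).restrict (p := V) (q := V) (fun x _ => hNV x) with hn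
  have haeval : ∀ (f : ℂ[X]) (y : V), (aeval N f) (y : H) = ((aeval n f) y : V) := by
    intro f
    induction f using Polynomial.induction_on' with
    | add p q hp hq => intro y; simp [hp, hq]
    | monomial k c =>
      intro y
      have : ∀ k : ℕ, (N ^ k) (y : H) = ((n ^ k) y : V) := by
        intro k
        induction k with
        | zero => simp
        | succ k ih => rw [pow_succ', pow_succ', mul_apply_eq_comp, ih]; rfl
      simp only [aeval_monomial, mul_apply_eq_comp, Module.End.mul_apply, this]
      simp [Algebra.algebraMap_eq_smul_one]
  -- One application of `N` lands in `V`, where Cayley–Hamilton applies; hence the extra factor `X`.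
  set f : ℂ[X] := n.charpoly * X with hf
  have hf0 : f ≠ 0 := mul_ne_zero n.charpoly_monic.ne_zero X_ne_zero
  have haz : aeval N f = 0 := by
    ext y
    rw [hf, map_mul, aeval_X, mul_apply_eq_comp]
    have := haeval n.charpoly ⟨N y, hNV y⟩
    rw [LinearMap.aeval_self_charpoly] at this
    exact this
  cases subsingleton_or_nontrivial (H →L[ℂ] H) with
  | inl hs => rw [spectrum.of_subsingleton]; exact Set.finite_empty
  | inr hnt =>
    have hsub : spectrum ℂ N ⊆ {x | f.IsRoot x} := by
      intro x hx
      have := spectrum.subset_polynomial_aeval N f ⟨x, hx, rfl⟩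
      rw [haz, spectrum.zero_eq] at this
      exact this
    refine Set.Finite.of_finite_image (f := ((↑) : ℝ → ℂ)) ?_ (Complex.ofReal_injective.injOn)
    refine (f.finite_setOfPred_isRoot hf0).subset ?_
    rintro _ ⟨x, hx, rfl⟩
    exact hsub ((spectrum.algebraMap_mem_iff ℂ).2 hx)

end FiniteRank

/-! ### Rellich's theorem by Kato's reduction -/

section Reduction

variable {H : Type*} [NormedAddCommGroup H] [InnerProductSpace ℂ H] [CompleteSpace H]

theorem im_inner_isSelfAdjoint {a : H →L[ℂ] H} (ha : IsSelfAdjoint a) (v : H) :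
    star (inner ℂ v (a v)) = inner ℂ v (a v) := by
  have h1 : inner ℂ (a v) v = inner ℂ v (a v) :=
    (ContinuousLinearMap.isSelfAdjoint_iff_isSymmetric.1 ha) v v
  have h2 := inner_conj_symm (𝕜 := ℂ) v (a v)
  rw [h1] at h2
  exact h2

/-- Subtract the scalar part of `M P` and divide by a power of `z - x₀`: unless `M P` is scalar,
this leaves a self-adjoint family whose value at `x₀` is nonzero and has a zero diagonal entry. -/
theorem exists_scalar_part {P M : ℂ → H →L[ℂ] H} {x₀ : ℝ} (hP : AnalyticAt ℂ P x₀)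
    (hM : AnalyticAt ℂ M x₀) (hPi : ∀ᶠ z in 𝓝 (x₀ : ℂ), P z * P z = P z)
    (hc : ∀ᶠ z in 𝓝 (x₀ : ℂ), Commute (P z) (M z))
    (hPs : ∀ᶠ x : ℝ in 𝓝 x₀, IsSelfAdjoint (P x)) (hMs : ∀ᶠ x : ℝ in 𝓝 x₀, IsSelfAdjoint (M x))
    {v : H} (hv : P x₀ v = v) (hv0 : v ≠ 0) :
    ∃ τ : ℂ → ℂ, AnalyticAt ℂ τ x₀ ∧ ((∀ᶠ z in 𝓝 (x₀ : ℂ), M z * P z = τ z • P z) ∨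
      ∃ (k : ℕ) (N : ℂ → H →L[ℂ] H), AnalyticAt ℂ N x₀ ∧ N x₀ ≠ 0 ∧
        (∀ᶠ z in 𝓝 (x₀ : ℂ), M z * P z - τ z • P z = (z - x₀) ^ k • N z) ∧
        (∀ᶠ z in 𝓝 (x₀ : ℂ), N z * P z = N z) ∧ (∀ᶠ z in 𝓝 (x₀ : ℂ), P z * N z = N z) ∧
        (∀ᶠ x : ℝ in 𝓝 x₀, IsSelfAdjoint (N x)) ∧ inner ℂ v (N x₀ v) = 0) := by
  have hin : ∀ {F : ℂ → H →L[ℂ] H}, AnalyticAt ℂ F x₀ →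
      AnalyticAt ℂ (fun z => inner ℂ v (F z v)) x₀ := fun hF =>
    ((innerSL ℂ v).comp (ContinuousLinearMap.apply ℂ H v)).analyticAt _ |>.comp hF
  have hvv : inner ℂ v (P x₀ v) ≠ 0 := by rwa [hv, inner_self_ne_zero]
  have hMP := hM.mul hP
  -- A quotient of matrix entries at the fixed vector `v`: analytic in `z`, real on the real axis,
  -- and chosen to cancel the entry ⟨v, · v⟩ of `M P - τ P`.
  set τ : ℂ → ℂ := fun z => inner ℂ v ((M z * P z) v) / inner ℂ v (P z v) with hτdef
  have hτ : AnalyticAt ℂ τ x₀ := (hin hMP).div (hin hP) hvv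
  have hG : AnalyticAt ℂ (fun z => M z * P z - τ z • P z) x₀ := hMP.sub (hτ.smul hP)
  refine ⟨τ, hτ, ?_⟩
  by_cases hz : ∀ᶠ z in 𝓝 (x₀ : ℂ), M z * P z - τ z • P z = 0
  · exact Or.inl (hz.mono fun z h => sub_eq_zero.1 h)
  right
  obtain ⟨k, N, hN, hN0, hGN⟩ := hG.exists_eventuallyEq_pow_smul_nonzero_iff.2 hz
  have hNe : ∀ᶠ z in 𝓝[≠] (x₀ : ℂ), N z = ((z - x₀) ^ k)⁻¹ • (M z * P z - τ z • P z) := by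
    filter_upwards [hGN.filter_mono nhdsWithin_le_nhds, self_mem_nhdsWithin] with z h1 h2
    rw [h1, inv_smul_smul₀ (pow_ne_zero k (sub_ne_zero.2 h2))]
  -- The remaining properties hold off `x₀`, where `N` is an explicit quotient, and pass to `x₀` by
  -- continuity.
  have hPc := hP.continuousAt
  have hNc := hN.continuousAt
  refine ⟨k, N, hN, hN0, hGN, ?_, ?_, ?_, ?_⟩
  · refine ((hNc.mul hPc).eventuallyEq_nhds_iff_eventuallyEq_nhdsNE hNc).1 ?_
    filter_upwards [hNe, hPi.filter_mono nhdsWithin_le_nhds] with z h1 h2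
    change N z * P z = N z
    rw [h1, smul_mul_assoc, sub_mul, smul_mul_assoc, mul_assoc, h2]
  · refine ((hPc.mul hNc).eventuallyEq_nhds_iff_eventuallyEq_nhdsNE hNc).1 ?_
    filter_upwards [hNe, hPi.filter_mono nhdsWithin_le_nhds,
      hc.filter_mono nhdsWithin_le_nhds] with z h1 h2 h3
    change P z * N z = N z
    rw [h1, mul_smul_comm, mul_sub, mul_smul_comm, ← mul_assoc, h3.eq, mul_assoc, h2]
  · have hofR : Tendsto ((↑) : ℝ → ℂ) (𝓝[≠] x₀) (𝓝[≠] (x₀ : ℂ)) :=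
      tendsto_nhdsWithin_iff.2 ⟨Complex.continuous_ofReal.continuousAt.mono_left nhdsWithin_le_nhds,
        eventually_nhdsWithin_of_forall fun x hx => by simpa using hx⟩
    have hNr : ContinuousAt (fun x : ℝ => N x) x₀ :=
      ContinuousAt.comp (g := N) hNc Complex.continuous_ofReal.continuousAt
    refine (hNr.star.eventuallyEq_nhds_iff_eventuallyEq_nhdsNE hNr).1 ?_
    filter_upwards [hofR.eventually hNe, hPs.filter_mono nhdsWithin_le_nhds,
      hMs.filter_mono nhdsWithin_le_nhds,
      (Complex.continuous_ofReal.continuousAt.eventually hc).filter_mono nhdsWithin_le_nhds]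
      with x h1 h2 h3 h4
    have hMPs : IsSelfAdjoint (M x * P x) := by
      rw [isSelfAdjoint_iff, star_mul, h2.star_eq, h3.star_eq, h4.eq]
    have hτs : star (τ x) = τ x := by
      rw [hτdef, star_div₀, im_inner_isSelfAdjoint hMPs, im_inner_isSelfAdjoint h2]
    change star (N x) = N x
    rw [h1, star_smul, star_sub, star_smul, hMPs.star_eq, h2.star_eq, hτs]
    congr 1
    simp
  · have := ((hin hN).continuousAt.eventuallyEq_nhds_iff_eventuallyEq_nhdsNE
      (continuousAt_const (y := (0 : ℂ)))).1 ?_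
    · exact this.self_of_nhds
    filter_upwards [hNe, ((hin hP).continuousAt.eventually_ne hvv).filter_mono
      nhdsWithin_le_nhds] with z h1 h2
    rw [h1]
    simp only [smul_apply, sub_apply, inner_smul_right,
      inner_sub_right, hτdef]
    rw [div_mul_cancel₀ _ h2]
    simp

/-- Rellich's theorem, through Kato's reduction process: a self-adjoint analytic family restricted
to an analytic family of finite rank projections can be diagonalized analytically. -/
theorem exists_isDiagonalizationAt (n : ℕ) : ∀ {P M : ℂ → H →L[ℂ] H} {x₀ : ℝ},
    AnalyticAt ℂ P x₀ → AnalyticAt ℂ M x₀ → (∀ᶠ z in 𝓝 (x₀ : ℂ), P z * P z = P z) →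
    (∀ᶠ z in 𝓝 (x₀ : ℂ), Commute (P z) (M z)) → (∀ᶠ x : ℝ in 𝓝 x₀, IsSelfAdjoint (P x)) →
    (∀ᶠ x : ℝ in 𝓝 x₀, IsSelfAdjoint (M x)) →
    FiniteDimensional ℂ (LinearMap.range (P x₀ : H →ₗ[ℂ] H)) →
    Module.finrank ℂ (LinearMap.range (P x₀ : H →ₗ[ℂ] H)) = n →
    ∃ (ι : Type) (_ : Fintype ι) (s : ι → ℂ → ℂ) (p : ι → ℂ → H →L[ℂ] H),
      IsDiagonalizationAt M P x₀ s p := by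
  induction n using Nat.strong_induction_on with
  | _ n ih =>
  intro P M x₀ hP hM hPi hc hPs hMs hfd hrank
  by_cases hP0 : P x₀ = 0
  · have hz : ∀ᶠ z in 𝓝 (x₀ : ℂ), P z = 0 := by
      filter_upwards [hPi, hP.continuousAt.norm.eventually_lt (g := fun _ => (1 : ℝ))
        continuousAt_const (by simp [hP0])] with z h1 h2
      exact IsIdempotentElem.eq_zero_of_norm_lt_one h1 h2
    exact ⟨Empty, inferInstance, fun j => j.elim, fun j => j.elim,
      ⟨fun j => j.elim, fun j => j.elim, fun j => j.elim, Eventually.of_forall fun _ j => j.elim,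
        Eventually.of_forall fun _ j => j.elim, hz.mono fun z h => by simp [h],
        Eventually.of_forall fun _ j => j.elim, Eventually.of_forall fun _ j => j.elim,
        Eventually.of_forall fun _ j => j.elim⟩⟩
  obtain ⟨u, hu⟩ : ∃ u, P x₀ u ≠ 0 := by
    by_contra! h
    exact hP0 (ContinuousLinearMap.ext h)
  have hv : P x₀ (P x₀ u) = P x₀ u := congrArg (fun r : H →L[ℂ] H => r u) hPi.self_of_nhds
  obtain ⟨τ, hτ, hscalar | ⟨k, N, hN, hN0, hGN, hNP, hPN, hNs, hvN⟩⟩ :=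
    exists_scalar_part hP hM hPi hc hPs hMs hv hu
  · refine ⟨Unit, inferInstance, fun _ => τ, fun _ => P, ⟨fun _ => hτ, fun _ => hP, fun _ => hP0,
      hPi.mono fun _ h _ => h, Eventually.of_forall fun _ _ _ h => absurd rfl h,
      Eventually.of_forall fun _ => by simp, hscalar.mono fun _ h _ => h, ?_,
      Eventually.of_forall fun _ _ _ h => absurd rfl h⟩⟩
    filter_upwards [hscalar, hc] with z h1 h2 _
    rw [h2.eq, h1]
  · have hfin := finite_spectrum_of_mul_eq hPN.self_of_nhds
    obtain ⟨P', κ, hκ, hP', hev, hP's, hP'0, hNP', hmax⟩ :=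
      exists_analytic_subprojection hN hP hPi hNP hPN hNs hN0 hfin
    obtain ⟨g1, g2, g3, g4⟩ := hev.self_of_nhds
    have hPi0 := hPi.self_of_nhds
    -- Otherwise `N x₀` would be the scalar κ ≠ 0 on the range of `P x₀`, against its zero entry at
    -- `P x₀ u`. So both `P'` and `P - P'` have smaller rank, and the induction applies to each.
    have hne : P' x₀ ≠ P x₀ := by
      intro he
      rw [he, hNP.self_of_nhds] at hNP'
      have : inner ℂ (P x₀ u) (N x₀ (P x₀ u)) = κ * inner ℂ (P x₀ u) (P x₀ u) := by
        conv_lhs => rw [hNP']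
        rw [smul_apply, hv]
        exact inner_smul_right_eq_smul _ _ κ |>.trans (Complex.real_smul ..)
      rw [hvN] at this
      have := mul_eq_zero.1 this.symm
      simp [hκ, hu] at this
    obtain ⟨fd1, lt1⟩ := finrank_range_lt_of_ne g1 g4 g3 hne
    have hsubi : (P x₀ - P' x₀) * (P x₀ - P' x₀) = P x₀ - P' x₀ := by
      simp only [sub_mul, mul_sub, hPi0, g1, g3, g4]; abel
    obtain ⟨fd2, lt2⟩ := finrank_range_lt_of_ne (p := P x₀) (q := P x₀ - P' x₀) hsubi
      (by rw [mul_sub, hPi0, g4]) (by rw [sub_mul, hPi0, g3]) (by simpa using hP'0)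
    obtain ⟨ι, i1, s, p, hd⟩ := ih _ (hrank ▸ lt1) hP' hN (hev.mono fun z h => h.1)
      (hev.mono fun z h => h.2.1) hP's hNs fd1 rfl
    obtain ⟨ι', i2, t, q, hd'⟩ := ih _ (hrank ▸ lt2) (P := fun z => P z - P' z) (hP.sub hP') hN
      (by
        filter_upwards [hPi, hev] with z h1 ⟨h2, h3, h4, h5⟩
        simp only [sub_mul, mul_sub, h1, h2, h4, h5]; abel)
      (by
        filter_upwards [hNP, hPN, hev] with z h1 h2 ⟨h3, h4, h5, h6⟩
        exact Commute.sub_left (h2.trans h1.symm) h4)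
      (by filter_upwards [hPs, hP's] with x h1 h2 using h1.sub h2) hNs fd2 rfl
    have hsum := hd.sumElim hd' (by
      filter_upwards [hPi, hev] with z h1 ⟨h2, h3, h4, h5⟩
      simp [mul_sub, sub_mul, h2, h4, h5]) (by
      intro i j he
      -- Under `P'` all eigenvalues at `x₀` equal κ. An eigenvalue κ under `P - P'` is impossible,
      -- since `P' x₀` already captures everything on which `N x₀` acts as κ.
      have e1 : s i x₀ = κ := by
        have a1 := hd.left.self_of_nhds i
        have a2 := (hd.mul_p.self_of_nhds i).1
        rw [← a2, ← mul_assoc, hNP', smul_mul_assoc, a2] at a1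
        by_contra hne'
        have : (s i x₀ - κ) • p i x₀ = 0 := by
          rw [sub_smul, ← a1, Complex.coe_smul, sub_self]
        exact hd.ne_zero i ((smul_eq_zero.1 this).resolve_left (sub_ne_zero.2 hne'))
      have a1 := hd'.left.self_of_nhds j
      have a2 := (hd'.mul_p.self_of_nhds j).1
      rw [← he, e1, Complex.coe_smul] at a1
      have a3 := hmax _ a1
      rw [← a2, ← mul_assoc, mul_sub, g3, g1, sub_self, zero_mul] at a3
      exact hd'.ne_zero j (by rw [← a2, ← a3]))
    have hsum' : IsDiagonalizationAt N P x₀ (Sum.elim s t) (Sum.elim p q) := by simpa using hsum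
    exact ⟨ι ⊕ ι', inferInstance, _, _, hsum'.ofAffine hτ hc hGN⟩

end Reduction

/-! ### Resolvents and linear pencils -/

namespace UnboundedOp

variable {H : Type*} [NormedAddCommGroup H] [InnerProductSpace ℂ H] {D : Submodule ℂ H}

theorem shift_apply (A : D →ₗ[ℂ] H) (lam : ℂ) (f : D) :
    shift (LinearPMap.mk D A) lam f = A f - lam • (f : H) := rfl

theorem mem_eigenspace {A : D →ₗ[ℂ] H} {lam : ℂ} {x : H} :
    x ∈ eigenspace (LinearPMap.mk D A) lam ↔ ∃ f : D, A f = lam • (f : H) ∧ (f : H) = x := by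
  simp only [eigenspace, Submodule.mem_map, LinearMap.mem_ker]
  constructor
  · rintro ⟨f, hf, rfl⟩
    exact ⟨f, sub_eq_zero.1 hf, rfl⟩
  · rintro ⟨f, hf, rfl⟩
    exact ⟨f, sub_eq_zero.2 hf, rfl⟩

/-- `R` is the resolvent `(A - ζ)⁻¹`. -/
def IsResolvent (A : D →ₗ[ℂ] H) (ζ : ℂ) (R : H →L[ℂ] H) : Prop :=
  (∀ y : H, ∃ f : D, (f : H) = R y ∧ A f - ζ • (f : H) = y) ∧ ∀ f : D, R (A f - ζ • (f : H)) = f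

theorem isRegularValue_iff {A : D →ₗ[ℂ] H} {ζ : ℂ} :
    IsRegularValue (LinearPMap.mk D A) ζ ↔ ∃ R, IsResolvent A ζ R := Iff.rfl

namespace IsResolvent

variable {A : D →ₗ[ℂ] H} {ζ : ℂ} {R : H →L[ℂ] H}

theorem sub_eq {lam : ℂ} {R' : H →L[ℂ] H} (h : IsResolvent A ζ R) (h' : IsResolvent A lam R') :
    R' - R = (lam - ζ) • (R * R') := by
  ext y
  obtain ⟨f, hf, hy⟩ := h'.1 y
  have := h.2 f
  have e : A f - ζ • (f : H) = y + (lam - ζ) • (f : H) := by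
    rw [← hy, sub_smul]; abel
  rw [e, map_add, map_smul, hf] at this
  simp only [sub_apply, smul_apply, mul_apply_eq_comp]
  exact sub_eq_iff_eq_add'.2 this.symm

/-- For `f = R y` one has `(A - lam) f = y - (lam - ζ) R y`. Together with `range_shift` this turns
kernel and range of the unbounded operator into questions about the bounded `R`. -/
theorem mem_eigenspace_iff (h : IsResolvent A ζ R) {lam : ℂ} {x : H} :
    x ∈ eigenspace (LinearPMap.mk D A) lam ↔ (lam - ζ) • R x = x := by
  rw [mem_eigenspace]
  constructor
  · rintro ⟨f, hf, rfl⟩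
    have := h.2 f
    rwa [hf, ← sub_smul, map_smul] at this
  · intro hx
    obtain ⟨f, hf, hy⟩ := h.1 x
    refine ⟨(lam - ζ) • f, ?_, ?_⟩
    · rw [map_smul, sub_eq_iff_eq_add.1 hy, hf, Submodule.coe_smul, hf, hx, smul_add, smul_comm,
        hx, ← add_smul]
      simp
    · rw [Submodule.coe_smul, hf, hx]

theorem range_shift (h : IsResolvent A ζ R) (lam : ℂ) :
    (LinearMap.range (shift (LinearPMap.mk D A) lam) : Set H) =
      Set.range fun y => y - (lam - ζ) • R y := by
  ext x
  constructor
  · rintro ⟨f, rfl⟩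
    refine ⟨A f - ζ • (f : H), ?_⟩
    change A f - ζ • (f : H) - (lam - ζ) • R (A f - ζ • (f : H)) = A f - lam • (f : H)
    rw [h.2, sub_smul]; abel
  · rintro ⟨y, rfl⟩
    obtain ⟨f, hf, hy⟩ := h.1 y
    refine ⟨f, ?_⟩
    rw [shift_apply]
    simp only [← hf]
    rw [← hy, sub_smul]; abel

theorem isUnit_one_sub {lam : ℂ} {R' : H →L[ℂ] H} (h : IsResolvent A ζ R)
    (h' : IsResolvent A lam R') : IsUnit (1 - (lam - ζ) • R) := by
  have e1 := h.sub_eq h'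
  have e2 := h'.sub_eq h
  refine ⟨⟨1 - (lam - ζ) • R, 1 + (lam - ζ) • R', ?_, ?_⟩, rfl⟩
  · simp only [sub_mul, mul_add, one_mul, mul_one, smul_mul_assoc, mul_smul_comm, ← e1]
    module
  · have e3 : R' - R = (lam - ζ) • (R' * R) := by
      rw [← neg_sub R R', e2, ← neg_smul]; ring_nf
    simp only [mul_sub, add_mul, one_mul, mul_one, smul_mul_assoc, mul_smul_comm, ← e3]
    module

theorem isSelfAdjoint [CompleteSpace H] {ζ : ℝ} (h : IsResolvent A ζ R)
    (hA : ∀ f g : D, inner ℂ (A f) (g : H) = inner ℂ (f : H) (A g)) : IsSelfAdjoint R := by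
  rw [ContinuousLinearMap.isSelfAdjoint_iff_isSymmetric]
  intro x y
  obtain ⟨f, hf, hx⟩ := h.1 x
  obtain ⟨g, hg, hy⟩ := h.1 y
  change inner ℂ (R x) y = inner ℂ x (R y)
  rw [← hf, ← hg, ← hx, ← hy, inner_sub_left, inner_sub_right, hA, inner_smul_left,
    inner_smul_right, Complex.conj_ofReal]

end IsResolvent

/-- A family `T z = T w + (z - w) B` with bounded `B`, symmetric for real `z`. -/
structure IsSymmetricPencil (T : ℂ → D →ₗ[ℂ] H) (B : H →L[ℂ] H) : Prop where
  apply_eq : ∀ z w f, T z f = T w f + (z - w) • B f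
  symm : ∀ (x : ℝ) (f g : D), inner ℂ (T x f) (g : H) = inner ℂ (f : H) (T x g)

/-- Factor `T z - ζ = (1 + (z - z₀) B R₀)(T z₀ - ζ)`; the first factor is invertible near `z₀`, and
inversion is analytic. -/
theorem IsSymmetricPencil.exists_analytic_resolvent [CompleteSpace H] {T : ℂ → D →ₗ[ℂ] H}
    {B : H →L[ℂ] H} (hT : IsSymmetricPencil T B) {z₀ ζ : ℂ} {R₀ : H →L[ℂ] H}
    (hR₀ : IsResolvent (T z₀) ζ R₀) :
    ∃ R : ℂ → H →L[ℂ] H, AnalyticAt ℂ R z₀ ∧ ∀ᶠ z in 𝓝 z₀, IsResolvent (T z) ζ (R z) := by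
  set K : ℂ → H →L[ℂ] H := fun z => 1 + (z - z₀) • (B * R₀) with hK
  have hKa : AnalyticAt ℂ K z₀ :=
    analyticAt_const.add ((analyticAt_id.sub analyticAt_const).smul analyticAt_const)
  have hK0 : K z₀ = ((1 : (H →L[ℂ] H)ˣ) : H →L[ℂ] H) := by simp [hK]
  refine ⟨fun z => R₀ * Ring.inverse (K z), ?_, ?_⟩
  · refine analyticAt_const.mul (AnalyticAt.comp (g := Ring.inverse) ?_ hKa)
    rw [hK0]
    exact analyticAt_inverse 1
  · have hu : ∀ᶠ z in 𝓝 z₀, IsUnit (K z) :=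
      hKa.continuousAt.eventually (by rw [hK0]; exact Units.nhds 1)
    filter_upwards [hu] with z hz
    have key : ∀ y' : H, ∀ f : D, (f : H) = R₀ y' → T z₀ f - ζ • (f : H) = y' →
        T z f - ζ • (f : H) = K z y' := by
      intro y' f hf hy
      rw [hT.apply_eq z z₀, hf, ← hf, add_sub_right_comm, hy, hf]
      simp [hK]
    refine ⟨fun y => ?_, fun f => ?_⟩
    · obtain ⟨f, hf, hy⟩ := hR₀.1 (Ring.inverse (K z) y)
      refine ⟨f, hf, ?_⟩
      rw [key _ f hf hy]
      exact congrArg (fun r : H →L[ℂ] H => r y) (Ring.mul_inverse_cancel _ hz)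
    · rw [key _ f (hR₀.2 f).symm rfl, mul_apply_eq_comp]
      have : Ring.inverse (K z) (K z (T z₀ f - ζ • (f : H))) = T z₀ f - ζ • (f : H) :=
        congrArg (fun r : H →L[ℂ] H => r (T z₀ f - ζ • (f : H))) (Ring.inverse_mul_cancel _ hz)
      rw [this, hR₀.2]

/-- A regular value stays regular under small perturbations: no eigenvalues nearby. -/
theorem IsSymmetricPencil.eventually_eigenspace_eq_bot {T : ℂ → D →ₗ[ℂ] H}
    {B : H →L[ℂ] H} (hT : IsSymmetricPencil T B) {z₀ lam₀ : ℂ}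
    (h : IsRegularValue (LinearPMap.mk D (T z₀)) lam₀) :
    ∀ᶠ w in 𝓝 (z₀, lam₀), eigenspace (LinearPMap.mk D (T w.1)) w.2 = ⊥ := by
  obtain ⟨R, hR⟩ := isRegularValue_iff.1 h
  have hcont : ContinuousAt (fun w : ℂ × ℂ =>
      ‖R * ((w.2 - lam₀) • (1 : H →L[ℂ] H) - (w.1 - z₀) • B)‖) (z₀, lam₀) := by fun_prop
  have hsmall := hcont.eventually_lt (g := fun _ => (1 : ℝ)) continuousAt_const (by simp)
  filter_upwards [hsmall] with w hw
  rw [eq_bot_iff]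
  intro x hx
  obtain ⟨f, hf, rfl⟩ := mem_eigenspace.1 hx
  have e1 : T z₀ f - lam₀ • (f : H) =
      ((w.2 - lam₀) • (1 : H →L[ℂ] H) - (w.1 - z₀) • B) (f : H) := by
    rw [hT.apply_eq w.1 z₀, ← eq_sub_iff_add_eq] at hf
    rw [hf]
    simp [sub_smul]; abel
  have e2 := hR.2 f
  rw [e1] at e2
  have := (R * ((w.2 - lam₀) • (1 : H →L[ℂ] H) - (w.1 - z₀) • B)).le_opNorm (f : H)
  rw [mul_apply_eq_comp, e2] at this
  have h0 : ‖(f : H)‖ = 0 := by nlinarith [norm_nonneg (f : H)]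
  simpa using h0

/-- Near `z₀` the eigenvalues of `T z` close to `lam₀` are the values at `z` of finitely many
analytic functions `l j`, with analytic eigenprojectors `p j`. -/
structure IsEigenSplittingAt (T : ℂ → D →ₗ[ℂ] H) (z₀ lam₀ : ℂ) {ι : Type}
    (l : ι → ℂ → ℂ) (p : ι → ℂ → H →L[ℂ] H) : Prop where
  analyticAt_l : ∀ j, AnalyticAt ℂ (l j) z₀
  analyticAt_p : ∀ j, AnalyticAt ℂ (p j) z₀
  projection : ∀ᶠ z in 𝓝 z₀, ∀ j, p j z ≠ 0 ∧ p j z * p j z = p j z ∧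
    LinearMap.range (p j z : H →ₗ[ℂ] H) ≤ eigenspace (LinearPMap.mk D (T z)) (l j z)
  isEigenprojector : ∀ᶠ z in 𝓝 z₀, ∀ j, (∀ i, i ≠ j → l i z ≠ l j z) →
    IsEigenprojector (LinearPMap.mk D (T z)) (l j z) (p j z)
  distinct : ∀ᶠ z in 𝓝[≠] z₀, ∀ i j, i ≠ j → l i z ≠ l j z
  finrank_eq : ∀ j, ∀ᶠ z in 𝓝 z₀, Module.finrank ℂ (LinearMap.range (p j z : H →ₗ[ℂ] H)) =
    Module.finrank ℂ (LinearMap.range (p j z₀ : H →ₗ[ℂ] H))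
  exhausts : ∀ᶠ w in 𝓝 (z₀, lam₀), eigenspace (LinearPMap.mk D (T w.1)) w.2 ≠ ⊥ →
    ∃ j, w.2 = l j w.1
  unique : ∀ᶠ z in 𝓝 z₀, ∀ j, Module.finrank ℂ (LinearMap.range (p j z : H →ₗ[ℂ] H)) =
    Module.finrank ℂ (eigenspace (LinearPMap.mk D (T z₀)) lam₀) → ∀ i, i = j

end UnboundedOp

/-! ### From one isolated eigenvalue to analytic branches -/

section Cluster

/-- If `1` is the only point of the spectrum of a self-adjoint element that is not small, then the
spectral projection at `1` is close to this element. -/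
theorem IsSelfAdjoint.exists_near_projection {A : Type*} [CStarAlgebra A] {a : A}
    (ha : IsSelfAdjoint a) (hs : ∀ σ ∈ spectrum ℂ a, σ = 1 ∨ ‖σ‖ ≤ 1 / 100) :
    ∃ p : A, IsSelfAdjoint p ∧ p * p = p ∧ a * p = p ∧ p * a = p ∧ ‖a - p‖ ≤ 1 / 100 := by
  have hsR : ∀ t ∈ spectrum ℝ a, t = 1 ∨ |t| ≤ 1 / 100 := by
    intro t ht
    have := hs t ((spectrum.algebraMap_mem_iff ℂ).2 ht)
    simpa using this
  -- A continuous cut-off, 0 for t ≤ 1/4 and 1 for t ≥ 3/4; on the spectrum it is the indicator of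
  -- 1.
  set f : ℝ → ℝ := fun t => max 0 (min 1 (2 * t - 1 / 2)) with hf
  have hfc : Continuous f := by fun_prop
  have hf1 : ∀ t, t = 1 → f t = 1 := by rintro t rfl; norm_num [hf]
  have hf0 : ∀ t, |t| ≤ 1 / 100 → f t = 0 := by
    intro t ht
    have := (abs_le.1 ht).2
    rw [hf]
    exact max_eq_left ((min_le_right _ _).trans (by linarith))
  have hmul : a * cfc f a = cfc (fun t => t * f t) a := by
    rw [cfc_mul (fun t => t) f a continuousOn_id hfc.continuousOn, cfc_id' ℝ a ha]
  have hap : a * cfc f a = cfc f a := by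
    rw [hmul]
    refine cfc_congr fun t ht => ?_
    rcases hsR t ht with h | h
    · simp [h]
    · simp [hf0 t h]
  have hps : IsSelfAdjoint (cfc f a) := IsSelfAdjoint.cfc
  refine ⟨cfc f a, hps, ?_, hap, ?_, ?_⟩
  · rw [← cfc_mul f f a hfc.continuousOn hfc.continuousOn]
    refine cfc_congr fun t ht => ?_
    rcases hsR t ht with h | h
    · simp [hf1 t h]
    · simp [hf0 t h]
  · have := congrArg star hap
    rwa [star_mul, hps.star_eq, ha.star_eq] at this
  · have : a - cfc f a = cfc (fun t => t - f t) a := by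
      rw [cfc_sub (fun t => t) f a continuousOn_id hfc.continuousOn, cfc_id' ℝ a ha]
    rw [this]
    refine norm_cfc_le (by norm_num) fun t ht => ?_
    rcases hsR t ht with h | h
    · rw [hf1 t h, h]; norm_num
    · rw [hf0 t h, sub_zero]; exact h

end Cluster

namespace UnboundedOp

section Pointwise

variable {H : Type*} [NormedAddCommGroup H] [InnerProductSpace ℂ H] {D : Submodule ℂ H}

/-- The component `x - P x` satisfies the eigenvalue equation of `S (1 - P)` for σ, but |σ| exceeds
the norm of that operator. -/
theorem apply_eq_self_of_eigenvector {S P : H →L[ℂ] H} (hP : P * P = P) (hc : Commute P S)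
    (hn : ‖S * (1 - P)‖ < 1 / 2) {σ : ℂ} (hσ : 1 / 2 ≤ ‖σ‖) {x : H} (hx : S x = σ • x) :
    P x = x := by
  have hPS : P (S x) = S (P x) := congrArg (fun r : H →L[ℂ] H => r x) hc.eq
  have hPP : P (P x) = P x := congrArg (fun r : H →L[ℂ] H => r x) hP
  have h1 : (S * (1 - P)) (x - P x) = σ • (x - P x) := by
    simp only [mul_apply_eq_comp, sub_apply, map_sub, one_apply_eq_self, hPP, sub_self, map_zero,
      sub_zero, ← hPS, hx, smul_sub, map_smul]
  have h2 := (S * (1 - P)).le_opNorm (x - P x)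
  rw [h1, norm_smul] at h2
  have h3 : ‖x - P x‖ = 0 := by
    by_contra h
    have : 0 < ‖x - P x‖ := lt_of_le_of_ne (norm_nonneg _) (Ne.symm h)
    nlinarith
  exact (sub_eq_zero.1 (norm_eq_zero.1 h3)).symm

/-- On the range of `1 - P` the operator `σ - S` is inverted by a Neumann series, as `S` has norm
below 1/2 ≤ |σ| there. -/
theorem exists_preimage_of_apply_eq_zero [CompleteSpace H] {S P : H →L[ℂ] H} (hP : P * P = P)
    (hc : Commute P S) (hn : ‖S * (1 - P)‖ < 1 / 2) {σ : ℂ} (hσ : 1 / 2 ≤ ‖σ‖) {y : H}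
    (hy : P y = 0) : ∃ u, σ • u - S u = y := by
  have hσ0 : σ ≠ 0 := by rintro rfl; norm_num at hσ
  have hlt : ‖σ⁻¹ • (S * (1 - P))‖ < 1 := by
    rw [norm_smul, norm_inv]
    calc ‖σ‖⁻¹ * ‖S * (1 - P)‖ ≤ 2 * ‖S * (1 - P)‖ := by
          gcongr
          exact inv_le_of_inv_le₀ (by norm_num) (by linarith)
      _ < 1 := by linarith
  set U := Units.oneSub _ hlt with hU
  set u₀ := (↑U⁻¹ : H →L[ℂ] H) y with hu₀
  have h1 : (U : H →L[ℂ] H) u₀ = y := congrArg (fun r : H →L[ℂ] H => r y) U.mul_inv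
  rw [hU, Units.val_oneSub] at h1
  have hcE : S * (1 - P) = (1 - P) * S := by rw [mul_sub, sub_mul, hc.eq, mul_one, one_mul]
  have hEE : (1 - P) * (1 - P) = 1 - P := by
    simp only [sub_mul, mul_sub, hP, one_mul, mul_one]; abel
  have hSE : (1 - P) * (S * (1 - P)) = S * (1 - P) := by rw [hcE, ← mul_assoc, hEE]
  have h2 : (1 - P) ((1 - σ⁻¹ • (S * (1 - P)) : H →L[ℂ] H) u₀) = y := by
    rw [h1]; simp [hy]
  rw [← mul_apply_eq_comp, mul_sub, mul_one, mul_smul_comm, hSE] at h2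
  refine ⟨σ⁻¹ • (1 - P) u₀, ?_⟩
  rw [smul_inv_smul₀ hσ0, map_smul, ← h2]
  rfl

variable {A : D →ₗ[ℂ] H} {ζ : ℂ} {R : H →L[ℂ] H}

/-- The substitution `lam = ζ + c / σ` matches eigenvalues of `A` with nonzero eigenvalues of the
scaled resolvent `c R`. -/
theorem IsResolvent.mem_eigenspace_iff_smul (h : IsResolvent A ζ R) {c σ : ℂ} (hσ : σ ≠ 0) {x : H} :
    x ∈ eigenspace (LinearPMap.mk D A) (ζ + c / σ) ↔ (c • R) x = σ • x := by
  rw [h.mem_eigenspace_iff, add_sub_cancel_left, div_eq_inv_mul, mul_smul, inv_smul_eq_iff₀ hσ]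
  rfl

theorem IsResolvent.mem_range_shift_iff (h : IsResolvent A ζ R) {c σ : ℂ} (hσ : σ ≠ 0) {x : H} :
    x ∈ LinearMap.range (shift (LinearPMap.mk D A) (ζ + c / σ)) ↔
      ∃ u, σ • u - (c • R) u = x := by
  rw [← SetLike.mem_coe, h.range_shift, add_sub_cancel_left]
  constructor
  · rintro ⟨y, rfl⟩
    refine ⟨σ⁻¹ • y, ?_⟩
    simp only [smul_inv_smul₀ hσ, map_smul, div_eq_inv_mul, mul_smul]; rfl
  · rintro ⟨u, rfl⟩
    refine ⟨σ • u, ?_⟩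
    simp only [map_smul, smul_smul, div_mul_cancel₀ _ hσ]; rfl

variable {ι : Type} {s : ι → ℂ} {p : ι → H →L[ℂ] H}

theorem apply_eq_zero_of_eigenvector {S : H →L[ℂ] H} (hr : ∀ j, p j * S = s j • p j) {σ : ℂ}
    {i : ι} (hσ : s i ≠ σ) {x : H} (hx : S x = σ • x) : p i x = 0 := by
  have h1 : p i (S x) = s i • p i x := congrArg (fun r : H →L[ℂ] H => r x) (hr i)
  rw [hx, map_smul, ← sub_eq_zero, ← sub_smul] at h1
  exact (smul_eq_zero.1 h1).resolve_left (sub_ne_zero.2 hσ.symm)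

/-- The eigenprojectors of `A` from a diagonalization of its resolvent on a cluster. -/
theorem IsResolvent.isEigenprojector [CompleteSpace H] [Fintype ι] (h : IsResolvent A ζ R) {c : ℂ}
    {P : H →L[ℂ] H}
    (hP : P * P = P) (hPS : Commute P (c • R)) (hn : ‖(c • R) * (1 - P)‖ < 1 / 2)
    (hi : ∀ j, p j * p j = p j) (hsum : ∑ j, p j = P)
    (hl : ∀ j, (c • R) * p j = s j • p j) (hr : ∀ j, p j * (c • R) = s j • p j)
    (hs : ∀ j, 1 / 2 ≤ ‖s j‖) {j : ι} (hne : ∀ i, i ≠ j → s i ≠ s j) :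
    IsEigenprojector (LinearPMap.mk D A) (ζ + c / s j) (p j) := by
  classical
  have hs0 : s j ≠ 0 := by intro h0; have := hs j; rw [h0] at this; norm_num at this
  refine ⟨hi j, ?_, ?_⟩
  · ext x
    rw [h.mem_eigenspace_iff_smul hs0]
    constructor
    · intro hx
      have hx' := apply_eq_self_of_mem_range (hi j) hx
      have := congrArg (fun r : H →L[ℂ] H => r x) (hl j)
      simpa only [mul_apply_eq_comp, smul_apply, hx'] using this
    · intro hx
      have hPx := apply_eq_self_of_eigenvector hP hPS hn (hs j) hx
      rw [← hsum, sum_apply, Finset.sum_eq_single j (fun i _ hij =>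
        apply_eq_zero_of_eigenvector hr (hne i hij) hx) (by simp)] at hPx
      exact ⟨x, hPx⟩
  · ext x
    rw [h.mem_range_shift_iff hs0, LinearMap.mem_ker]
    constructor
    · intro hx
      change p j x = 0 at hx
      obtain ⟨u, hu⟩ := exists_preimage_of_apply_eq_zero hP hPS hn (hs j) (y := x - P x) (by
        rw [map_sub, ← mul_apply_eq_comp, hP, sub_self])
      -- The part of `x` outside the cluster is solved by `u`; on the range of `p i` the operator `s
      -- j - c R` is the nonzero scalar `s j - s i`.
      refine ⟨u + ∑ i ∈ Finset.univ.erase j, (s j - s i)⁻¹ • p i x, ?_⟩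
      have key : ∀ i ∈ Finset.univ.erase j,
          s j • ((s j - s i)⁻¹ • p i x) - (c • R) ((s j - s i)⁻¹ • p i x) = p i x := by
        intro i hij
        have h1 : (c • R) (p i x) = s i • p i x := congrArg (fun r : H →L[ℂ] H => r x) (hl i)
        rw [map_smul, h1, smul_comm (s j), ← smul_sub, ← sub_smul, inv_smul_smul₀]
        exact sub_ne_zero.2 (hne i (Finset.ne_of_mem_erase hij)).symm
      rw [smul_add, map_add, add_sub_add_comm, hu, Finset.smul_sum, map_sum,
        ← Finset.sum_sub_distrib, Finset.sum_congr rfl key]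
      have : P x = ∑ i ∈ Finset.univ.erase j, p i x := by
        rw [← hsum, sum_apply, ← Finset.add_sum_erase _ _ (Finset.mem_univ j),
          hx, zero_add]
      rw [← this]; abel
    · rintro ⟨u, rfl⟩
      change p j (s j • u - (c • R) u) = 0
      have h1 : p j ((c • R) u) = s j • p j u := congrArg (fun r : H →L[ℂ] H => r u) (hr j)
      rw [map_sub, map_smul, h1, sub_self]

end Pointwise

variable {H : Type*} [NormedAddCommGroup H] [InnerProductSpace ℂ H] {D : Submodule ℂ H}

/-- If σ ≠ 1 and |σ| > 1/100, then `lam = ζ + (lam₀ - ζ) / σ` differs from `lam₀` by at most 101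
|lam₀ - ζ| < δ, so it is a regular value and σ is not in the spectrum. -/
theorem IsResolvent.spectrum_subset {A : D →ₗ[ℂ] H} {ζ lam₀ : ℂ} {R : H →L[ℂ] H}
    (h : IsResolvent A ζ R) {δ : ℝ}
    (hreg : ∀ lam, lam ≠ lam₀ → ‖lam - lam₀‖ < δ → IsRegularValue (LinearPMap.mk D A) lam)
    (hζ : lam₀ ≠ ζ) (hδ : 101 * ‖lam₀ - ζ‖ < δ) :
    ∀ σ ∈ spectrum ℂ ((lam₀ - ζ) • R), σ = 1 ∨ ‖σ‖ ≤ 1 / 100 := by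
  intro σ hσ
  by_contra! hcon
  obtain ⟨h1, h100⟩ := hcon
  have hσ0 : σ ≠ 0 := by rintro rfl; norm_num at h100
  have hc : lam₀ - ζ ≠ 0 := sub_ne_zero.2 hζ
  obtain ⟨R', hR'⟩ := isRegularValue_iff.1 (hreg (ζ + (lam₀ - ζ) / σ) (by
      intro he
      rw [← eq_sub_iff_add_eq', div_eq_iff hσ0] at he
      exact h1 (mul_left_cancel₀ hc (by rw [mul_one]; exact he.symm))) (by
      have : ζ + (lam₀ - ζ) / σ - lam₀ = (lam₀ - ζ) * (σ⁻¹ - 1) := by field_simp; ring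
      rw [this, norm_mul]
      have h2 : ‖σ⁻¹ - 1‖ ≤ 101 := by
        refine (norm_sub_le _ _).trans ?_
        rw [norm_inv, norm_one]
        have : ‖σ‖⁻¹ ≤ 100 := inv_le_of_inv_le₀ (by norm_num) (by linarith)
        linarith
      nlinarith [norm_nonneg (lam₀ - ζ)]))
  have hu := h.isUnit_one_sub hR'
  rw [add_sub_cancel_left] at hu
  refine hσ ?_
  have : algebraMap ℂ (H →L[ℂ] H) σ - (lam₀ - ζ) • R =
      algebraMap ℂ (H →L[ℂ] H) σ * (1 - ((lam₀ - ζ) / σ) • R) := by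
    rw [mul_sub, mul_one, Algebra.algebraMap_eq_smul_one, smul_mul_assoc, one_mul, smul_smul,
      mul_div_cancel₀ _ hσ0]
  rw [spectrum.mem_resolventSet_iff, this]
  exact ((isUnit_iff_ne_zero.2 hσ0).map (algebraMap ℂ (H →L[ℂ] H))).mul hu

variable [CompleteSpace H]

/-- The local structure theorem: the scaled resolvent is diagonalized on the analytic projection
grown from its spectral projection at 1, and its eigenvalues `s j` are carried back by `ζ + c / s
j`. -/
theorem exists_isEigenSplittingAt {T : ℂ → D →ₗ[ℂ] H} {B : H →L[ℂ] H}
    (hT : IsSymmetricPencil T B) {x₀ lam₀ : ℝ}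
    (hdisc : HasDiscreteSpectrum (LinearPMap.mk D (T x₀))) :
    ∃ (ι : Type) (_ : Finite ι) (l : ι → ℂ → ℂ) (p : ι → ℂ → H →L[ℂ] H),
      IsEigenSplittingAt T x₀ lam₀ l p := by
  by_cases hspec : (lam₀ : ℂ) ∉ spec (LinearPMap.mk D (T x₀))
  · refine ⟨Empty, inferInstance, fun j => j.elim, fun j => j.elim,
      ⟨fun j => j.elim, fun j => j.elim, Eventually.of_forall fun _ j => j.elim,
        Eventually.of_forall fun _ j => j.elim, Eventually.of_forall fun _ j => j.elim,
        fun j => j.elim, ?_, Eventually.of_forall fun _ j => j.elim⟩⟩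
    filter_upwards [hT.eventually_eigenspace_eq_bot (not_not.1 hspec)] with w h1 h2
    exact absurd h1 h2
  obtain ⟨hiso, m, hm0, hm⟩ := hdisc _ (not_not.1 hspec)
  rw [eventually_nhdsWithin_iff, Metric.eventually_nhds_iff] at hiso
  obtain ⟨δ, hδ, hball⟩ := hiso
  have hreg : ∀ lam : ℂ, lam ≠ lam₀ → ‖lam - lam₀‖ < δ →
      IsRegularValue (LinearPMap.mk D (T x₀)) lam := fun lam h1 h2 =>
    not_not.1 (hball (by rwa [dist_eq_norm]) h1)
  -- Real, so that the resolvent is self-adjoint on the real axis; the distance δ/200 makes 101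
  -- |lam₀ - ζ| < δ.
  set ζ : ℝ := lam₀ - δ / 200 with hζ
  have hcval : (lam₀ : ℂ) - ζ = ((δ / 200 : ℝ) : ℂ) := by rw [hζ]; push_cast; ring
  have hc0 : (lam₀ : ℂ) - ζ ≠ 0 := by rw [hcval]; exact_mod_cast (by positivity)
  have hcn : ‖(lam₀ : ℂ) - ζ‖ = δ / 200 := by
    rw [hcval, Complex.norm_real, Real.norm_of_nonneg (by positivity)]
  obtain ⟨R₀, hR₀⟩ := isRegularValue_iff.1 (hreg ζ (sub_ne_zero.1 hc0).symm
    (by rw [norm_sub_rev, hcn]; linarith))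
  obtain ⟨R, hR, hRes⟩ := hT.exists_analytic_resolvent hR₀
  have hspecS := hRes.self_of_nhds.spectrum_subset hreg (sub_ne_zero.1 hc0)
    (by rw [hcn]; linarith)
  set c : ℂ := (lam₀ : ℂ) - ζ with hc
  set S : ℂ → H →L[ℂ] H := fun z => c • R z with hSdef
  have hS : AnalyticAt ℂ S x₀ := (analyticAt_const (v := c)).smul hR
  have hSs : ∀ᶠ x : ℝ in 𝓝 x₀, IsSelfAdjoint (S x) := by
    filter_upwards [Complex.continuous_ofReal.continuousAt.eventually hRes] with x h1
    have hs := h1.isSelfAdjoint (hT.symm x)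
    rw [isSelfAdjoint_iff, hSdef]
    simp only [star_smul, hs.star_eq]
    rw [hcval, Complex.star_def, Complex.conj_ofReal]
  obtain ⟨p₀, hp₀s, hp₀, hSp, hpS, hnear⟩ := hSs.self_of_nhds.exists_near_projection hspecS
  obtain ⟨P, hP, hP0, hPev⟩ := exists_analyticAt_idempotent hS hp₀
    (norm_le_one_of_isSelfAdjoint_idempotent hp₀s hp₀) (hSp.trans hpS.symm) hnear
  have hPi : ∀ᶠ z in 𝓝 (x₀ : ℂ), P z * P z = P z := hPev.mono fun z h => h.1
  have hPS : ∀ᶠ z in 𝓝 (x₀ : ℂ), Commute (P z) (S z) := hPev.mono fun z h => h.2.1 _ (.refl _)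
  have hPs : ∀ᶠ x : ℝ in 𝓝 x₀, IsSelfAdjoint (P x) := by
    filter_upwards [hSs, Complex.continuous_ofReal.continuousAt.eventually hPev] with x h1 h2
    exact h2.2.2 h1
  have hsmall : ∀ᶠ z in 𝓝 (x₀ : ℂ), ‖S z * (1 - P z)‖ < 1 / 2 := by
    refine ((hS.continuousAt.mul (continuousAt_const.sub hP.continuousAt)).norm).eventually_lt
      continuousAt_const ?_
    have : S x₀ * (1 - P x₀) = S x₀ - p₀ := by rw [mul_sub, mul_one, hP0, hSp]
    simp only [Pi.mul_apply, Pi.sub_apply]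
    refine lt_of_le_of_lt (b := ‖S x₀ - p₀‖) (le_of_eq (congrArg _ this)) (by linarith)
  have hrange : LinearMap.range (P x₀ : H →ₗ[ℂ] H) =
      eigenspace (LinearPMap.mk D (T x₀)) lam₀ := by
    have e1 : (lam₀ : ℂ) = ζ + c / 1 := by rw [hc]; ring
    ext x
    rw [e1, hRes.self_of_nhds.mem_eigenspace_iff_smul one_ne_zero, one_smul]
    constructor
    · intro hx
      rw [← apply_eq_self_of_mem_range hPi.self_of_nhds hx, hP0]
      exact congrArg (fun r : H →L[ℂ] H => r x) hSp
    · intro hx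
      exact ⟨x, apply_eq_self_of_eigenvector hPi.self_of_nhds hPS.self_of_nhds
        hsmall.self_of_nhds (σ := 1) (by norm_num) (by rw [one_smul]; exact hx)⟩
  have hfd : FiniteDimensional ℂ (LinearMap.range (P x₀ : H →ₗ[ℂ] H)) := by
    rw [hrange]
    exact FiniteDimensional.of_finrank_pos (by omega)
  obtain ⟨ι, hι, s, p, hd⟩ := exists_isDiagonalizationAt _ hP hS hPi hPS hPs hSs hfd rfl
  have hs1 : ∀ j, s j x₀ = 1 := by
    intro j
    have a1 := hd.left.self_of_nhds j
    have a2 := (hd.mul_p.self_of_nhds j).1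
    have a3 : S x₀ * p j x₀ = p j x₀ := by rw [← a2, ← mul_assoc, hP0, hSp]
    rw [a3] at a1
    have : (1 - s j x₀) • p j x₀ = 0 := by rw [sub_smul, one_smul, ← a1, sub_self]
    exact (sub_eq_zero.1 ((smul_eq_zero.1 this).resolve_right (hd.ne_zero j))).symm
  have hshalf : ∀ᶠ z in 𝓝 (x₀ : ℂ), ∀ j, 1 / 2 ≤ ‖s j z‖ := by
    rw [eventually_all]
    intro j
    refine (continuousAt_const.eventually_lt (hd.analyticAt_s j).continuousAt.norm ?_).mono
      fun z h => le_of_lt h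
    rw [hs1, norm_one]; norm_num
  have hs0 : ∀ᶠ z in 𝓝 (x₀ : ℂ), ∀ j, s j z ≠ 0 := hshalf.mono fun z h j h0 => by
    have := h j
    rw [h0] at this
    norm_num at this
  have hlne : ∀ {z : ℂ} {i j : ι}, (ζ : ℂ) + c / s i z ≠ ζ + c / s j z ↔ s i z ≠ s j z := by
    intro z i j
    rw [not_iff_not, add_right_inj, div_eq_mul_inv, div_eq_mul_inv, mul_right_inj' hc0, inv_inj]
  have hpne : ∀ᶠ z in 𝓝 (x₀ : ℂ), ∀ j, p j z ≠ 0 := by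
    rw [eventually_all]
    exact fun j => (hd.analyticAt_p j).continuousAt.eventually_ne (hd.ne_zero j)
  have hrankle : ∀ᶠ z in 𝓝 (x₀ : ℂ), ∀ j,
      LinearMap.range (p j z : H →ₗ[ℂ] H) ≤ LinearMap.range (P z : H →ₗ[ℂ] H) := by
    filter_upwards [hd.mul_p] with z h j
    rintro _ ⟨x, rfl⟩
    exact ⟨p j z x, congrArg (fun r : H →L[ℂ] H => r x) (h j).1⟩
  have hrank : ∀ {q : ℂ → H →L[ℂ] H}, AnalyticAt ℂ q x₀ →
      (∀ᶠ z in 𝓝 (x₀ : ℂ), q z * q z = q z) →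
      FiniteDimensional ℂ (LinearMap.range (q x₀ : H →ₗ[ℂ] H)) →
      ∀ᶠ z in 𝓝 (x₀ : ℂ), FiniteDimensional ℂ (LinearMap.range (q z : H →ₗ[ℂ] H)) ∧
        Module.finrank ℂ (LinearMap.range (q z : H →ₗ[ℂ] H)) =
          Module.finrank ℂ (LinearMap.range (q x₀ : H →ₗ[ℂ] H)) := by
    intro q hq hqi hqf
    filter_upwards [hqi, (continuousAt_const.sub hq.continuousAt).norm.eventually_lt
      (f := fun z => ‖q x₀ - q z‖) (g := fun _ => (1 : ℝ)) continuousAt_const (by simp)]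
      with z h1 h2
    exact finrank_range_eq_of_norm_sub_lt_one hqi.self_of_nhds h1 h2
  refine ⟨ι, inferInstance, fun j z => ζ + c / s j z, p, ⟨fun j => ?_, hd.analyticAt_p, ?_, ?_, ?_,
    fun j => ?_, ?_, ?_⟩⟩
  · exact analyticAt_const.add (analyticAt_const.div (hd.analyticAt_s j) (by rw [hs1]; simp))
  · filter_upwards [hpne, hd.idem, hd.left, hs0, hRes] with z h1 h2 h3 h4 h5 j
    refine ⟨h1 j, h2 j, ?_⟩
    rintro _ ⟨x, rfl⟩
    rw [h5.mem_eigenspace_iff_smul (h4 j)]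
    exact congrArg (fun r : H →L[ℂ] H => r x) (h3 j)
  · filter_upwards [hRes, hPi, hPS, hsmall, hd.idem, hd.sum, hd.left, hd.right, hshalf]
      with z h1 h2 h3 h4 h5 h7 h8 h9 h10 j hj
    exact h1.isEigenprojector h2 h3 h4 h5 h7 h8 h9 h10 fun i hi => hlne.1 (hj i hi)
  · filter_upwards [hd.distinct] with z h1 i j hij
    exact hlne.2 (h1 i j hij)
  · refine (hrank (hd.analyticAt_p j) (hd.idem.mono fun z h => h j) ?_).mono fun z h => h.2
    exact Submodule.finiteDimensional_of_le (hrankle.self_of_nhds j)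
  · have hσc : ContinuousAt (fun w : ℂ × ℂ => ‖w.2 - ζ‖) ((x₀ : ℂ), (lam₀ : ℂ)) := by fun_prop
    -- This gives |c / (w.2 - ζ)| ≥ 1/2, so eigenvectors for `w.2` lie in the range of `P w.1`; if
    -- no `s j` matched, every `p j` would kill them.
    have e1 : ∀ᶠ w : ℂ × ℂ in 𝓝 ((x₀ : ℂ), (lam₀ : ℂ)), ‖w.2 - ζ‖ < 2 * ‖c‖ := by
      refine hσc.eventually_lt continuousAt_const ?_
      have : 0 < ‖c‖ := norm_pos_iff.2 hc0
      simp only [← hc]; linarith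
    have e2 : ∀ᶠ w : ℂ × ℂ in 𝓝 ((x₀ : ℂ), (lam₀ : ℂ)), w.2 - ζ ≠ 0 :=
      ContinuousAt.eventually_ne (by fun_prop) hc0
    have hfst : ∀ {q : ℂ → Prop}, (∀ᶠ z in 𝓝 (x₀ : ℂ), q z) →
        ∀ᶠ w : ℂ × ℂ in 𝓝 ((x₀ : ℂ), (lam₀ : ℂ)), q w.1 := fun h =>
      continuous_fst.continuousAt.eventually h
    filter_upwards [e1, e2, hfst hRes, hfst hPi, hfst hPS, hfst hsmall, hfst hd.sum,
      hfst hd.right] with w h1 h2 h3 h4 h5 h6 h7 h8 hw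
    obtain ⟨x, hx, hx0⟩ := Submodule.exists_mem_ne_zero_of_ne_bot hw
    have hσ0 : c / (w.2 - ζ) ≠ 0 := div_ne_zero hc0 h2
    have hw2 : w.2 = ζ + c / (c / (w.2 - ζ)) := by field_simp; ring
    rw [hw2, h3.mem_eigenspace_iff_smul hσ0] at hx
    have hhalf : 1 / 2 ≤ ‖c / (w.2 - ζ)‖ := by
      rw [norm_div, le_div_iff₀ (norm_pos_iff.2 h2)]; linarith
    have hPx := apply_eq_self_of_eigenvector h4 h5 h6 hhalf hx
    by_contra! hall
    have hz : ∀ j, p j w.1 x = 0 := fun j => apply_eq_zero_of_eigenvector h8 (by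
      intro he
      refine hall j ?_
      rw [he]; exact hw2) hx
    rw [← h7, sum_apply, Finset.sum_eq_zero fun j _ => hz j] at hPx
    exact hx0 hPx.symm
  · filter_upwards [hrank hP hPi hfd, hrankle, hpne, hd.orth, hd.idem, hd.mul_p]
      with z ⟨h1, h2⟩ h3 h4 h5 h6 h7 j hj i
    by_contra hij
    -- A `p j` of full rank has the range of `P z`, and orthogonality leaves no room for another
    -- nonzero `p i`.
    have heq := Submodule.eq_of_le_of_finrank_eq (h3 j) (by rw [hj, h2, hrange])
    refine h4 i (ContinuousLinearMap.ext fun x => ?_)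
    have hx : p i z x ∈ LinearMap.range (p j z : H →ₗ[ℂ] H) := by
      rw [heq]
      exact h3 i ⟨x, rfl⟩
    rw [← apply_eq_self_of_mem_range (h6 j) hx]
    exact congrArg (fun r : H →L[ℂ] H => r x) (h5 j i (Ne.symm hij))

end UnboundedOp

/-! ### Branches on the real line and their continuation -/

namespace UnboundedOp

variable {H : Type*} [NormedAddCommGroup H] [InnerProductSpace ℂ H] {D : Submodule ℂ H}

theorem IsEigenprojector.eq {A : H →ₗ.[ℂ] H} {lam : ℂ} {P Q : H →L[ℂ] H}
    (hP : IsEigenprojector A lam P) (hQ : IsEigenprojector A lam Q) : P = Q := by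
  ext x
  have h1 : x - Q x ∈ LinearMap.ker (P : H →ₗ[ℂ] H) := by
    rw [hP.2.2, ← hQ.2.2, LinearMap.mem_ker]
    change Q (x - Q x) = 0
    rw [map_sub, sub_eq_zero]
    exact (congrArg (fun r : H →L[ℂ] H => r x) hQ.1).symm
  have h2 : P (Q x) = Q x := by
    refine apply_eq_self_of_mem_range hP.1 ?_
    rw [hP.2.1, ← hQ.2.1]
    exact ⟨x, rfl⟩
  have h3 : P (x - Q x) = 0 := h1
  rw [map_sub, h2, sub_eq_zero] at h3
  exact h3

theorem eigenspace_ne_bot_of_range_le {A : H →ₗ.[ℂ] H} {lam : ℂ} {P : H →L[ℂ] H} (hP : P ≠ 0)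
    (h : LinearMap.range (P : H →ₗ[ℂ] H) ≤ eigenspace A lam) : eigenspace A lam ≠ ⊥ := by
  intro hb
  rw [hb, le_bot_iff] at h
  refine hP (ContinuousLinearMap.ext fun y => ?_)
  exact (Submodule.mem_bot ℂ).1 (h ▸ ⟨y, rfl⟩)

/-- `G` is, near the real point `x`, an analytic eigenvalue of multiplicity `m` together with its
eigenprojector, with a possible exception at `x` itself, where the eigenvalue may be of higher
multiplicity. -/
structure IsBranchAt (T : ℂ → D →ₗ[ℂ] H) (m : ℕ) (G : ℂ → ℂ × (H →L[ℂ] H)) (x : ℂ) : Prop where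
  analyticAt : AnalyticAt ℂ G x
  projection : ∀ᶠ z in 𝓝 x, (G z).2 ≠ 0 ∧ (G z).2 * (G z).2 = (G z).2 ∧
    LinearMap.range ((G z).2 : H →ₗ[ℂ] H) ≤ eigenspace (LinearPMap.mk D (T z)) (G z).1
  isEigenprojector : ∀ᶠ z in 𝓝[≠] x, IsEigenprojector (LinearPMap.mk D (T z)) (G z).1 (G z).2
  finrank_eq : ∀ᶠ z in 𝓝 x, Module.finrank ℂ (LinearMap.range ((G z).2 : H →ₗ[ℂ] H)) = m

/-- `F` is the restriction to the real line of a branch near `x`. -/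
def IsRealBranchAt (T : ℂ → D →ₗ[ℂ] H) (m : ℕ) (F : ℝ → ℂ × (H →L[ℂ] H)) (x : ℝ) : Prop :=
  ∃ G, IsBranchAt T m G x ∧ ∀ᶠ y : ℝ in 𝓝 x, F y = G y

variable {T : ℂ → D →ₗ[ℂ] H} {m : ℕ}

theorem tendsto_ofReal_nhdsNE (x : ℝ) : Tendsto ((↑) : ℝ → ℂ) (𝓝[≠] x) (𝓝[≠] (x : ℂ)) :=
  tendsto_nhdsWithin_iff.2 ⟨Complex.continuous_ofReal.continuousAt.mono_left nhdsWithin_le_nhds,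
    eventually_nhdsWithin_of_forall fun x hx => by simpa using hx⟩

theorem _root_.AnalyticAt.comp_ofReal_real {E : Type*} [NormedAddCommGroup E] [NormedSpace ℂ E]
    [NormedSpace ℝ E] [IsScalarTower ℝ ℂ E] {G : ℂ → E} {x : ℝ} (h : AnalyticAt ℂ G x) :
    AnalyticAt ℝ (fun y : ℝ => G y) x :=
  AnalyticAt.comp (g := G) (f := fun y : ℝ => (y : ℂ)) h.restrictScalars
    (Complex.ofRealCLM.analyticAt x)

theorem IsBranchAt.eventually [CompleteSpace H] {G : ℂ → ℂ × (H →L[ℂ] H)} {x : ℂ} (h : IsBranchAt T m G x) :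
    ∀ᶠ y in 𝓝 x, IsBranchAt T m G y := by
  have h3 : ∀ᶠ y in 𝓝 x, ∀ᶠ z in 𝓝[≠] y,
      IsEigenprojector (LinearPMap.mk D (T z)) (G z).1 (G z).2 := by
    obtain ⟨r, hr, hb⟩ := Metric.eventually_nhds_iff_ball.1
      (eventually_nhdsWithin_iff.1 h.isEigenprojector)
    filter_upwards [Metric.ball_mem_nhds x hr] with y hy
    by_cases hyx : y = x
    · rw [hyx]; exact h.isEigenprojector
    · refine Filter.Eventually.filter_mono nhdsWithin_le_nhds ?_
      filter_upwards [Metric.isOpen_ball.mem_nhds hy, isOpen_ne.mem_nhds hyx] with z h1 h2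
      exact hb z h1 h2
  filter_upwards [h.analyticAt.eventually_analyticAt, h.projection.eventually_nhds, h3,
    h.finrank_eq.eventually_nhds] with y a1 a2 a3 a4
  exact ⟨a1, a2, a3, a4⟩

namespace IsRealBranchAt

variable {F F' : ℝ → ℂ × (H →L[ℂ] H)} {x : ℝ}

theorem congr (h : IsRealBranchAt T m F x) (he : ∀ᶠ y in 𝓝 x, F' y = F y) :
    IsRealBranchAt T m F' x := by
  obtain ⟨G, hG, hF⟩ := h
  exact ⟨G, hG, by filter_upwards [he, hF] with y h1 h2 using h1.trans h2⟩

theorem analyticAt (h : IsRealBranchAt T m F x) : AnalyticAt ℝ F x := by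
  obtain ⟨G, hG, hF⟩ := h
  exact hG.analyticAt.comp_ofReal_real.congr (hF.mono fun y h => h.symm)

theorem projection (h : IsRealBranchAt T m F x) : ∀ᶠ y in 𝓝 x,
    (F y).2 ≠ 0 ∧ (F y).2 * (F y).2 = (F y).2 ∧
    LinearMap.range ((F y).2 : H →ₗ[ℂ] H) ≤ eigenspace (LinearPMap.mk D (T y)) (F y).1 := by
  obtain ⟨G, hG, hF⟩ := h
  filter_upwards [hF, Complex.continuous_ofReal.continuousAt.eventually hG.projection] with y h1 h2
  rwa [h1]

theorem isEigenprojector (h : IsRealBranchAt T m F x) : ∀ᶠ y in 𝓝[≠] x,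
    IsEigenprojector (LinearPMap.mk D (T (y : ℝ))) (F y).1 (F y).2 := by
  obtain ⟨G, hG, hF⟩ := h
  filter_upwards [hF.filter_mono nhdsWithin_le_nhds,
    (tendsto_ofReal_nhdsNE x).eventually hG.isEigenprojector] with y h1 h2
  rwa [h1]

theorem finrank_eq (h : IsRealBranchAt T m F x) :
    Module.finrank ℂ (LinearMap.range ((F x).2 : H →ₗ[ℂ] H)) = m := by
  obtain ⟨G, hG, hF⟩ := h
  rw [hF.self_of_nhds]
  exact hG.finrank_eq.self_of_nhds

end IsRealBranchAt

theorem eqOn_of_isRealBranchAt {F F' : ℝ → ℂ × (H →L[ℂ] H)} {J : Set ℝ} (hJ : J.OrdConnected)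
    (hF : ∀ x ∈ J, IsRealBranchAt T m F x) (hF' : ∀ x ∈ J, IsRealBranchAt T m F' x) {x₀ : ℝ}
    (hx₀ : x₀ ∈ J) (he : ∀ᶠ y in 𝓝 x₀, F y = F' y) : Set.EqOn F F' J :=
  AnalyticOnNhd.eqOn_of_preconnected_of_eventuallyEq (𝕜 := ℝ) (fun x hx => (hF x hx).analyticAt)
    (fun x hx => (hF' x hx).analyticAt) hJ.isPreconnected hx₀ he

variable {B : H →L[ℂ] H}

theorem IsSymmetricPencil.eigenvalue_real (hT : IsSymmetricPencil T B) {x : ℝ} {lam : ℂ}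
    (h : eigenspace (LinearPMap.mk D (T x)) lam ≠ ⊥) : ((lam.re : ℝ) : ℂ) = lam := by
  obtain ⟨u, hu, hu0⟩ := Submodule.exists_mem_ne_zero_of_ne_bot h
  obtain ⟨f, hf, rfl⟩ := mem_eigenspace.1 hu
  have := hT.symm x f f
  rw [hf, inner_smul_left, inner_smul_right] at this
  exact Complex.conj_eq_iff_re.1 (mul_right_cancel₀ (inner_self_ne_zero.2 hu0) this)

/-- Hellmann-Feynman: eigenvalues move at most as fast as the perturbation. -/
theorem IsSymmetricPencil.inner_sub (hT : IsSymmetricPencil T B) {x y : ℝ} {lam lam' : ℂ}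
    (hlam : ((lam.re : ℝ) : ℂ) = lam) {w u : H} (hw : w ∈ eigenspace (LinearPMap.mk D (T x)) lam)
    (hu : u ∈ eigenspace (LinearPMap.mk D (T y)) lam') :
    (lam' - lam) * inner ℂ w u = (y - x) * inner ℂ w (B u) := by
  obtain ⟨f, hf, rfl⟩ := mem_eigenspace.1 hw
  obtain ⟨g, hg, rfl⟩ := mem_eigenspace.1 hu
  have h1 := hT.symm x f g
  have h2 := hT.apply_eq y x g
  rw [hg] at h2
  have h3 := congrArg (fun v => inner ℂ (f : H) v) h2
  simp only [inner_add_right, inner_smul_right] at h3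
  rw [hf, inner_smul_left, ← hlam, Complex.conj_ofReal, hlam] at h1
  rw [sub_mul, h3, h1]
  ring

/-- Take an eigenvector `w` at `x` and the eigenvectors `(F y).2 w`, which tend to `w`. Dividing
`inner_sub` by `y - x` and letting `y → x` bounds |λ'| ‖w‖² by ‖B‖ ‖w‖². -/
theorem norm_deriv_le (hT : IsSymmetricPencil T B) {F : ℝ → ℂ × (H →L[ℂ] H)} {x : ℝ}
    (hF : IsRealBranchAt T m F x) : ‖deriv (fun y => (F y).1) x‖ ≤ ‖B‖ := by
  have hFa := hF.analyticAt
  have hd : HasDerivAt (fun y => (F y).1) (deriv (fun y => (F y).1) x) x :=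
    (analyticAt_fst.comp hFa).differentiableAt.hasDerivAt
  obtain ⟨h1, h2, h3⟩ := hF.projection.self_of_nhds
  obtain ⟨h, hh⟩ : ∃ h, (F x).2 h ≠ 0 := by
    by_contra! hc
    exact h1 (ContinuousLinearMap.ext hc)
  set w := (F x).2 h with hw
  have hwe : w ∈ eigenspace (LinearPMap.mk D (T x)) (F x).1 := h3 ⟨h, rfl⟩
  have hreal := hT.eigenvalue_real (Submodule.ne_bot_iff _ |>.2 ⟨w, hwe, hh⟩)
  have hww : (F x).2 w = w := apply_eq_self_of_mem_range h2 ⟨h, rfl⟩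
  have hu : Tendsto (fun y => (F y).2 w) (𝓝[≠] x) (𝓝 w) := by
    have : ContinuousAt (fun y => (F y).2 w) x :=
      (ContinuousLinearMap.apply ℂ H w).continuous.continuousAt.comp
        (continuous_snd.continuousAt.comp hFa.continuousAt)
    have := this.tendsto
    rw [hww] at this
    exact this.mono_left nhdsWithin_le_nhds
  have hlim1 := ((hasDerivAt_iff_tendsto_slope.1 hd).norm).mul
    ((tendsto_const_nhds (x := w)).inner (𝕜 := ℂ) hu).norm
  have hlim2 := (hu.norm).const_mul (‖w‖ * ‖B‖)
  have hle := le_of_tendsto_of_tendsto hlim1 hlim2 (by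
    filter_upwards [hF.projection.filter_mono nhdsWithin_le_nhds, self_mem_nhdsWithin]
      with y ⟨_, _, b3⟩ hy
    have hue : (F y).2 w ∈ eigenspace (LinearPMap.mk D (T y)) (F y).1 := b3 ⟨w, rfl⟩
    have hid := hT.inner_sub hreal hwe hue
    have hne : ((y : ℂ) - x) ≠ 0 := sub_ne_zero.2 (by simpa using hy)
    have : slope (fun y => (F y).1) x y * inner ℂ w ((F y).2 w) = inner ℂ w (B ((F y).2 w)) := by
      rw [slope_def_module, Complex.real_smul, mul_assoc, hid]
      push_cast
      rw [inv_mul_cancel_left₀ hne]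
    rw [← norm_mul, this]
    refine (norm_inner_le_norm _ _).trans ?_
    rw [mul_assoc]
    exact mul_le_mul_of_nonneg_left (B.le_opNorm _) (norm_nonneg _))
  rw [inner_self_eq_norm_sq_to_K] at hle
  have hw0 : 0 < ‖w‖ := norm_pos_iff.2 hh
  simp only [norm_pow, Complex.coe_algebraMap, Complex.norm_real, norm_norm] at hle
  have : ‖deriv (fun y => (F y).1) x‖ * ‖w‖ ^ 2 ≤ ‖B‖ * ‖w‖ ^ 2 := by
    refine hle.trans (le_of_eq (by ring))
  exact le_of_mul_le_mul_right this (by positivity)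

/-- On an interval, the eigenvalue of a branch is real and Lipschitz, so it extends continuously. -/
theorem exists_lipschitz_extension (hT : IsSymmetricPencil T B) {F : ℝ → ℂ × (H →L[ℂ] H)}
    {J : Set ℝ} (hJc : J.OrdConnected) (hF : ∀ x ∈ J, IsRealBranchAt T m F x) :
    ∃ g : ℝ → ℝ, Continuous g ∧ ∀ x ∈ J, (F x).1 = g x := by
  have hL : LipschitzOnWith ‖B‖₊ (fun y => (F y).1) J :=
    hJc.convex.lipschitzOnWith_of_nnnorm_deriv_le
      (fun x hx => (analyticAt_fst.comp (hF x hx).analyticAt).differentiableAt)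
      (fun x hx => norm_deriv_le hT (hF x hx))
  have hL' : LipschitzOnWith ‖B‖₊ (fun y => (F y).1.re) J := by
    refine LipschitzOnWith.of_dist_le_mul fun x hx y hy => ?_
    refine le_trans ?_ (hL.dist_le_mul x hx y hy)
    rw [dist_eq_norm, dist_eq_norm, ← Complex.sub_re]
    exact Complex.abs_re_le_norm _
  obtain ⟨g, hg, hgF⟩ := hL'.extend_real
  refine ⟨g, hg.continuous, fun x hx => ?_⟩
  rw [← hgF hx]
  obtain ⟨h1, -, h3⟩ := (hF x hx).projection.self_of_nhds
  exact (hT.eigenvalue_real (eigenspace_ne_bot_of_range_le h1 h3)).symm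

theorem IsEigenSplittingAt.isBranchAt {x₀ lam₀ : ℂ} {ι : Type} {l : ι → ℂ → ℂ}
    {p : ι → ℂ → H →L[ℂ] H} (h : IsEigenSplittingAt T x₀ lam₀ l p) {j : ι}
    (hm : Module.finrank ℂ (LinearMap.range (p j x₀ : H →ₗ[ℂ] H)) = m) :
    IsBranchAt T m (fun z => (l j z, p j z)) x₀ where
  analyticAt := (h.analyticAt_l j).prod (h.analyticAt_p j)
  projection := h.projection.mono fun z hz => hz j
  isEigenprojector := by
    filter_upwards [h.isEigenprojector.filter_mono nhdsWithin_le_nhds, h.distinct] with z h1 h2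
    exact h1 j fun i hi => h2 i j hi
  finrank_eq := (h.finrank_eq j).mono fun z hz => hz.trans hm

variable [CompleteSpace H]

/-- A branch on an open interval extends beyond the end points. -/
theorem exists_isBranchAt_of_mem_closure (hT : IsSymmetricPencil T B)
    (hdisc : ∀ x : ℝ, HasDiscreteSpectrum (LinearPMap.mk D (T x))) {F : ℝ → ℂ × (H →L[ℂ] H)}
    {J : Set ℝ} (hJo : IsOpen J) (hJc : J.OrdConnected) (hF : ∀ x ∈ J, IsRealBranchAt T m F x)
    {e : ℝ} (he : e ∈ closure J) (heJ : e ∉ J) :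
    ∃ G, IsBranchAt T m G e ∧ ∀ᶠ y : ℝ in 𝓝 e, y ∈ J → F y = G y := by
  obtain ⟨g, hgc, hg⟩ := exists_lipschitz_extension hT hJc hF
  obtain ⟨ι, hι, l, p, hs⟩ := exists_isEigenSplittingAt hT (lam₀ := g e) (hdisc e)
  have hofR : ∀ {q : ℂ → Prop}, (∀ᶠ z in 𝓝 (e : ℂ), q z) → ∀ᶠ y : ℝ in 𝓝 e, q y := fun h =>
    Complex.continuous_ofReal.continuousAt.eventually h
  have hdist : ∀ᶠ y : ℝ in 𝓝 e, y ≠ e → ∀ i j, i ≠ j → l i y ≠ l j y :=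
    eventually_nhdsWithin_iff.1 ((tendsto_ofReal_nhdsNE e).eventually hs.distinct)
  have hex : ∀ᶠ y : ℝ in 𝓝 e, eigenspace (LinearPMap.mk D (T y)) (g y : ℝ) ≠ ⊥ →
      ∃ j, ((g y : ℝ) : ℂ) = l j y := by
    have hc : ContinuousAt (fun y : ℝ => ((y : ℂ), ((g y : ℝ) : ℂ))) e := by fun_prop
    exact hc.eventually hs.exhausts
  have han : ∀ᶠ y : ℝ in 𝓝 e, ∀ j, AnalyticAt ℂ (l j) y ∧ AnalyticAt ℂ (p j) y := hofR (
    (eventually_all (ι := ι)).2 fun j => (hs.analyticAt_l j).eventually_analyticAt.and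
      (hs.analyticAt_p j).eventually_analyticAt)
  have hfin : ∀ᶠ y : ℝ in 𝓝 e, ∀ j, Module.finrank ℂ (LinearMap.range (p j y : H →ₗ[ℂ] H)) =
      Module.finrank ℂ (LinearMap.range (p j e : H →ₗ[ℂ] H)) := hofR ((eventually_all (ι := ι)).2 hs.finrank_eq)
  obtain ⟨r, hr, hball⟩ := Metric.eventually_nhds_iff_ball.1
    (hdist.and (hex.and (han.and (hfin.and (hofR hs.isEigenprojector)))))
  -- On this interval the local eigenvalues are pairwise distinct, because `e` itself is not in it.
  set J' := J ∩ Metric.ball e r with hJ'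
  have hJ'c : J'.OrdConnected := by
    rw [hJ', Real.ball_eq_Ioo]; exact hJc.inter Set.ordConnected_Ioo
  have hJ'o : IsOpen J' := hJo.inter Metric.isOpen_ball
  have hne : ∀ y ∈ J', y ≠ e := fun y hy h => heJ (h ▸ hy.1)
  have hcover : ∀ y ∈ J', ∃ j, ((g y : ℝ) : ℂ) = l j y := by
    intro y hy
    obtain ⟨b1, -, b3⟩ := (hF y hy.1).projection.self_of_nhds
    have := eigenspace_ne_bot_of_range_le b1 b3
    rw [hg y hy.1] at this
    exact (hball y hy.2).2.1 this
  obtain ⟨y₀, hy₀b, hy₀J⟩ := mem_closure_iff.1 he _ Metric.isOpen_ball (Metric.mem_ball_self hr)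
  have hy₀ : y₀ ∈ J' := ⟨hy₀J, hy₀b⟩
  obtain ⟨j, hj⟩ := hcover y₀ hy₀
  -- Only branch `j` takes the value `g y₀` at `y₀`, so near `y₀` the eigenvalue of `F` is `l j`.
  -- Uniqueness of eigenprojectors matches the projections off `y₀`, and the identity theorem
  -- spreads the equality over `J'`.
  have hother : ∀ᶠ y : ℝ in 𝓝 y₀, ∀ i, i ≠ j → ((g y : ℝ) : ℂ) ≠ l i y := by
    rw [eventually_all]
    intro i
    by_cases hij : i = j
    · exact Eventually.of_forall fun y h => absurd hij h
    have hc1 : ContinuousAt (fun y : ℝ => ((g y : ℝ) : ℂ)) y₀ := by fun_prop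
    have hc2 : ContinuousAt (fun y : ℝ => l i y) y₀ :=
      ContinuousAt.comp (g := l i) ((hball y₀ hy₀.2).2.2.1 i).1.continuousAt
        Complex.continuous_ofReal.continuousAt
    refine ((hc1.ne_iff_eventually_ne hc2).1 ?_).mono fun y h _ => h
    rw [hj]
    exact ((hball y₀ hy₀.2).1 (hne y₀ hy₀) i j hij).symm
  have hEq : Set.EqOn F (fun y : ℝ => (l j y, p j y)) J' := by
    refine AnalyticOnNhd.eqOn_of_preconnected_of_frequently_eq (𝕜 := ℝ)
      (fun x hx => (hF x hx.1).analyticAt)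
      (fun x hx => ?_) hJ'c.isPreconnected hy₀ (Eventually.frequently ?_)
    · obtain ⟨a1, a2⟩ := (hball x hx.2).2.2.1 j
      exact (a1.prod a2).comp_ofReal_real
    · filter_upwards [hother.filter_mono nhdsWithin_le_nhds,
        nhdsWithin_le_nhds (hJ'o.mem_nhds hy₀),
        (hF y₀ hy₀.1).isEigenprojector] with y b1 b2 b3
      obtain ⟨i, hi⟩ := hcover y b2
      have hij : i = j := by
        by_contra h
        exact b1 i h hi
      have h1 : (F y).1 = l j y := by rw [hg y b2.1, hi, hij]
      have h2 := (hball y b2.2).2.2.2.2 j fun i hi => (hball y b2.2).1 (hne y b2) i j hi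
      rw [h1] at b3
      exact Prod.ext h1 (b3.eq h2)
  refine ⟨_, hs.isBranchAt (j := j) ?_, ?_⟩
  · rw [← (hball y₀ hy₀.2).2.2.2.1 j, ← (hF y₀ hy₀.1).finrank_eq, hEq hy₀]
  · filter_upwards [Metric.ball_mem_nhds e hr] with y h1 h2 using hEq ⟨h2, h1⟩

/-- A continuous eigenvalue of constant multiplicity is locally analytic, with its
eigenprojector. -/
theorem exists_isBranchAt_of_constant_multiplicity (hT : IsSymmetricPencil T B) {x : ℝ}
    (hdisc : HasDiscreteSpectrum (LinearPMap.mk D (T x))) {μ : ℝ → ℝ} (hμ : ContinuousAt μ x)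
    (hm : ∀ᶠ y : ℝ in 𝓝 x, IsEigenvalueOfMultiplicity (LinearPMap.mk D (T y)) (μ y : ℝ) m) :
    ∃ G, IsBranchAt T m G x ∧ ∀ᶠ y : ℝ in 𝓝 x, (G y).1 = μ y ∧
      IsEigenprojector (LinearPMap.mk D (T y)) (μ y : ℝ) (G y).2 := by
  obtain ⟨ι, hι, l, p, hs⟩ := exists_isEigenSplittingAt hT (lam₀ := μ x) hdisc
  have hofR : ∀ {q : ℂ → Prop}, (∀ᶠ z in 𝓝 (x : ℂ), q z) → ∀ᶠ y : ℝ in 𝓝 x, q y := fun h =>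
    Complex.continuous_ofReal.continuousAt.eventually h
  have hex : ∀ᶠ y : ℝ in 𝓝 x, ∃ j, ((μ y : ℝ) : ℂ) = l j y := by
    have hc : ContinuousAt (fun y : ℝ => ((y : ℂ), ((μ y : ℝ) : ℂ))) x := by fun_prop
    filter_upwards [hc.eventually hs.exhausts, hm] with y h1 h2
    refine h1 fun hb => h2.1 ?_
    have h3 := h2.2
    rw [hb, finrank_bot] at h3
    exact h3.symm
  have hdist : ∀ᶠ y : ℝ in 𝓝[≠] x, ∀ i j, i ≠ j → l i y ≠ l j y :=
    (tendsto_ofReal_nhdsNE x).eventually hs.distinct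
  have hfin : ∀ᶠ y : ℝ in 𝓝 x, ∀ j, Module.finrank ℂ (LinearMap.range (p j y : H →ₗ[ℂ] H)) =
      Module.finrank ℂ (LinearMap.range (p j x : H →ₗ[ℂ] H)) := hofR ((eventually_all (ι := ι)).2 hs.finrank_eq)
  obtain ⟨y, h1, ⟨j, h2⟩, h3, h4, h5, h6⟩ := (hdist.and
    ((hex.and (hm.and ((hofR hs.isEigenprojector).and (hfin.and (hofR hs.unique))))).filter_mono
      nhdsWithin_le_nhds)).exists
  have hyj := h4 j fun i hi => h1 i j hi
  have hrank : Module.finrank ℂ (LinearMap.range (p j y : H →ₗ[ℂ] H)) = m := by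
    rw [hyj.2.1, ← h2, h3.2]
  -- The rank `m` of `p j` at a nearby point equals the multiplicity at `x`, the rank of the whole
  -- cluster, so there is no other branch.
  have huniq : ∀ i, i = j := h6 j (by rw [hrank]; exact hm.self_of_nhds.2.symm)
  refine ⟨_, hs.isBranchAt (j := j) (by rw [← h5, hrank]), ?_⟩
  filter_upwards [hex, hofR hs.isEigenprojector] with y ⟨i, hi⟩ h2
  rw [huniq i] at hi
  refine ⟨hi.symm, ?_⟩
  rw [hi]
  exact h2 j fun i hi' => absurd (huniq i) hi'

/-- A branch on a bounded symmetric interval extends to a larger one. -/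
theorem exists_extension_ball (hT : IsSymmetricPencil T B)
    (hdisc : ∀ x : ℝ, HasDiscreteSpectrum (LinearPMap.mk D (T x))) {F : ℝ → ℂ × (H →L[ℂ] H)}
    {x₀ c : ℝ} (hc : 0 < c) (hF : ∀ x ∈ Metric.ball x₀ c, IsRealBranchAt T m F x) :
    ∃ c' > c, ∃ F' : ℝ → ℂ × (H →L[ℂ] H), (∀ x ∈ Metric.ball x₀ c', IsRealBranchAt T m F' x) ∧
      ∀ᶠ y in 𝓝 x₀, F' y = F y := by
  classical
  have hoc : (Metric.ball x₀ c).OrdConnected := by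
    rw [Real.ball_eq_Ioo]; exact Set.ordConnected_Ioo
  have hend : ∀ e : ℝ, |e - x₀| = c →
      ∃ G, IsBranchAt T m G e ∧ ∀ᶠ y : ℝ in 𝓝 e, y ∈ Metric.ball x₀ c → F y = G y := by
    intro e he
    refine exists_isBranchAt_of_mem_closure hT hdisc Metric.isOpen_ball hoc hF ?_ ?_
    · rw [closure_ball _ hc.ne', Metric.mem_closedBall, Real.dist_eq, he]
    · rw [Metric.mem_ball, Real.dist_eq, he]; exact lt_irrefl _
  obtain ⟨G₁, hG₁, hFG₁⟩ := hend (x₀ + c) (by simp [abs_of_pos hc])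
  obtain ⟨G₂, hG₂, hFG₂⟩ := hend (x₀ - c) (by simp [abs_of_pos hc])
  obtain ⟨r₁, hr₁, hb₁⟩ := Metric.eventually_nhds_iff_ball.1
    (hFG₁.and (Complex.continuous_ofReal.continuousAt.eventually hG₁.eventually))
  obtain ⟨r₂, hr₂, hb₂⟩ := Metric.eventually_nhds_iff_ball.1
    (hFG₂.and (Complex.continuous_ofReal.continuousAt.eventually hG₂.eventually))
  -- The bound by `c` keeps the balls at the two end points on opposite sides of `x₀`, so the test
  -- `x₀ < y` selects the right branch.
  set r := min (min r₁ r₂) c with hr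
  have hr0 : 0 < r := lt_min (lt_min hr₁ hr₂) hc
  have hrr₁ : r ≤ r₁ := (min_le_left _ _).trans (min_le_left _ _)
  have hrr₂ : r ≤ r₂ := (min_le_left _ _).trans (min_le_right _ _)
  have hrc : r ≤ c := min_le_right _ _
  set F' : ℝ → ℂ × (H →L[ℂ] H) := fun y =>
    if y ∈ Metric.ball x₀ c then F y else if x₀ < y then G₁ y else G₂ y with hF'
  have hin : ∀ y ∈ Metric.ball x₀ c, F' y = F y := fun y hy => if_pos hy
  have hright : ∀ y ∈ Metric.ball (x₀ + c) r, F' y = G₁ y := by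
    intro y hy
    by_cases hyb : y ∈ Metric.ball x₀ c
    · rw [hin y hyb]
      exact (hb₁ y (Metric.ball_subset_ball hrr₁ hy)).1 hyb
    · have : x₀ < y := by
        rw [Metric.mem_ball, Real.dist_eq, abs_lt] at hy; linarith
      simp only [hF', if_neg hyb, if_pos this]
  have hleft : ∀ y ∈ Metric.ball (x₀ - c) r, F' y = G₂ y := by
    intro y hy
    by_cases hyb : y ∈ Metric.ball x₀ c
    · rw [hin y hyb]
      exact (hb₂ y (Metric.ball_subset_ball hrr₂ hy)).1 hyb
    · have : ¬ x₀ < y := by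
        rw [Metric.mem_ball, Real.dist_eq, abs_lt] at hy; linarith
      simp only [hF', if_neg hyb, if_neg this]
  refine ⟨c + r, by linarith, F', fun x hx => ?_, ?_⟩
  · by_cases hxb : x ∈ Metric.ball x₀ c
    · exact (hF x hxb).congr (by
        filter_upwards [Metric.isOpen_ball.mem_nhds hxb] with y hy using hin y hy)
    · rw [Metric.mem_ball, Real.dist_eq, abs_lt] at hx
      rw [Metric.mem_ball, Real.dist_eq, not_lt, le_abs] at hxb
      rcases hxb with h | h
      · have hx' : x ∈ Metric.ball (x₀ + c) r := by
          rw [Metric.mem_ball, Real.dist_eq, abs_lt]; constructor <;> linarith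
        exact ⟨G₁, (hb₁ x (Metric.ball_subset_ball hrr₁ hx')).2, by
          filter_upwards [Metric.isOpen_ball.mem_nhds hx'] with y hy using hright y hy⟩
      · have hx' : x ∈ Metric.ball (x₀ - c) r := by
          rw [Metric.mem_ball, Real.dist_eq, abs_lt]; constructor <;> linarith
        exact ⟨G₂, (hb₂ x (Metric.ball_subset_ball hrr₂ hx')).2, by
          filter_upwards [Metric.isOpen_ball.mem_nhds hx'] with y hy using hleft y hy⟩
  · filter_upwards [Metric.ball_mem_nhds x₀ hc] with y hy using hin y hy

omit [CompleteSpace H] in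
/-- Branches on concentric intervals with the same germ at the centre are restrictions of one. -/
theorem exists_glue_balls {x₀ : ℝ} {F₀ : ℝ → ℂ × (H →L[ℂ] H)} {s : Set ℝ} (hs : s.Nonempty)
    (hpos : ∀ c ∈ s, 0 < c)
    (hF : ∀ c ∈ s, ∃ F : ℝ → ℂ × (H →L[ℂ] H), (∀ x ∈ Metric.ball x₀ c, IsRealBranchAt T m F x) ∧
      ∀ᶠ y in 𝓝 x₀, F y = F₀ y) :
    ∃ F : ℝ → ℂ × (H →L[ℂ] H), (∀ c ∈ s, ∀ x ∈ Metric.ball x₀ c, IsRealBranchAt T m F x) ∧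
      ∀ᶠ y in 𝓝 x₀, F y = F₀ y := by
  classical
  choose! K hK hK₀ using hF
  set F : ℝ → ℂ × (H →L[ℂ] H) := fun y =>
    if h : ∃ c ∈ s, y ∈ Metric.ball x₀ c then K h.choose y else 0 with hFdef
  have hFK : ∀ c ∈ s, ∀ y ∈ Metric.ball x₀ c, F y = K c y := by
    intro c hc y hy
    have hex : ∃ c ∈ s, y ∈ Metric.ball x₀ c := ⟨c, hc, hy⟩
    have hFy : F y = K hex.choose y := dif_pos hex
    rw [hFy]
    obtain ⟨hd, hyd⟩ := hex.choose_spec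
    set d := hex.choose
    have hsub1 : Metric.ball x₀ (min d c) ⊆ Metric.ball x₀ d :=
      Metric.ball_subset_ball (min_le_left _ _)
    have hsub2 : Metric.ball x₀ (min d c) ⊆ Metric.ball x₀ c :=
      Metric.ball_subset_ball (min_le_right _ _)
    refine eqOn_of_isRealBranchAt (J := Metric.ball x₀ (min d c)) ?_
      (fun x hx => hK d hd x (hsub1 hx)) (fun x hx => hK c hc x (hsub2 hx))
      (Metric.mem_ball_self (lt_min (hpos d hd) (hpos c hc))) ?_ ?_
    · rw [Real.ball_eq_Ioo]; exact Set.ordConnected_Ioo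
    · filter_upwards [hK₀ d hd, hK₀ c hc] with y h1 h2 using h1.trans h2.symm
    · rw [Metric.mem_ball] at hy hyd ⊢
      exact lt_min hyd hy
  refine ⟨F, fun c hc x hx => (hK c hc x hx).congr ?_, ?_⟩
  · filter_upwards [Metric.isOpen_ball.mem_nhds hx] with y hy using hFK c hc y hy
  · obtain ⟨c, hc⟩ := hs
    filter_upwards [hK₀ c hc, Metric.ball_mem_nhds x₀ (hpos c hc)] with y h1 h2
    rw [hFK c hc y h2, h1]

/-- Every branch extends to the whole real line. -/
theorem exists_isRealBranchAt_global (hT : IsSymmetricPencil T B)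
    (hdisc : ∀ x : ℝ, HasDiscreteSpectrum (LinearPMap.mk D (T x))) {F₀ : ℝ → ℂ × (H →L[ℂ] H)}
    {x₀ : ℝ} (hF₀ : ∀ᶠ x in 𝓝 x₀, IsRealBranchAt T m F₀ x) :
    ∃ F : ℝ → ℂ × (H →L[ℂ] H), (∀ x, IsRealBranchAt T m F x) ∧ ∀ᶠ y in 𝓝 x₀, F y = F₀ y := by
  set s : Set ℝ := {c | 0 < c ∧ ∃ F : ℝ → ℂ × (H →L[ℂ] H),
    (∀ x ∈ Metric.ball x₀ c, IsRealBranchAt T m F x) ∧ ∀ᶠ y in 𝓝 x₀, F y = F₀ y} with hs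
  obtain ⟨c₀, hc₀, hb⟩ := Metric.eventually_nhds_iff_ball.1 hF₀
  have hne : s.Nonempty := ⟨c₀, hc₀, F₀, hb, Eventually.of_forall fun _ => rfl⟩
  obtain ⟨F, hF, hFF₀⟩ := exists_glue_balls hne (fun c hc => hc.1) (fun c hc => hc.2)
  -- If the radii were bounded, the glued branch would live on the ball of radius `sSup s` and
  -- extend past it.
  have hunb : ¬ BddAbove s := by
    intro hbdd
    have hpos : 0 < sSup s := hc₀.trans_le (le_csSup hbdd
      ⟨hc₀, F₀, hb, Eventually.of_forall fun _ => rfl⟩)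
    have hFsup : ∀ x ∈ Metric.ball x₀ (sSup s), IsRealBranchAt T m F x := by
      intro x hx
      obtain ⟨c, hc, hxc⟩ := exists_lt_of_lt_csSup hne (Metric.mem_ball.1 hx)
      exact hF c hc x hxc
    obtain ⟨c', hc', F', hF', hFF'⟩ := exists_extension_ball hT hdisc hpos hFsup
    refine absurd (le_csSup hbdd (a := c') ⟨hpos.trans hc', F', hF', ?_⟩) (not_le.2 hc')
    filter_upwards [hFF', hFF₀] with y h1 h2 using h1.trans h2
  refine ⟨F, fun x => ?_, hFF₀⟩
  obtain ⟨c, hc, hxc⟩ := not_bddAbove_iff.1 hunb (dist x x₀)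
  exact hF c hc x hxc

end UnboundedOp

/-! ### Connectedness of the complex neighbourhood and gluing -/

section Connectedness

/-- Polar coordinates present the punctured disc as a continuous image of a connected product. -/
theorem isPreconnected_ball_diff_center (x : ℂ) (r : ℝ) :
    IsPreconnected (Metric.ball x r \ {x}) := by
  have h : Metric.ball x r \ {x} =
      (fun q : ℝ × ℝ => x + q.1 * Complex.exp (q.2 * Complex.I)) '' (Set.Ioo 0 r ×ˢ Set.univ) := by
    ext z
    constructor
    · rintro ⟨hz, hzx⟩
      refine ⟨(‖z - x‖, (z - x).arg), ⟨⟨norm_pos_iff.2 (sub_ne_zero.2 hzx), ?_⟩, trivial⟩, ?_⟩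
      · rwa [← dist_eq_norm]
      · simp only [Complex.norm_mul_exp_arg_mul_I]; ring
    · rintro ⟨⟨ρ, θ⟩, ⟨⟨h0, h1⟩, -⟩, rfl⟩
      simp only at h0 h1 ⊢
      refine ⟨?_, ?_⟩
      · rw [Metric.mem_ball, dist_eq_norm, add_sub_cancel_left, norm_mul,
          Complex.norm_exp_ofReal_mul_I, mul_one, Complex.norm_real, Real.norm_of_nonneg h0.le]
        exact h1
      · rw [Set.mem_singleton_iff, add_eq_left]
        exact mul_ne_zero (by exact_mod_cast h0.ne') (Complex.exp_ne_zero _)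
  rw [h]
  exact (isPreconnected_Ioo.prod isPreconnected_univ).image _ (by fun_prop)

/-- A neighbourhood of the real line made of discs centred on it stays connected when some of the
centres are removed, provided each disc contains at most its own centre among them. -/
theorem isConnected_iUnion_ball_diff {r : ℝ → ℝ} (hr : ∀ x, 0 < r x) {S : Set ℝ}
    (hS : ∀ x : ℝ, ∀ y ∈ S, (y : ℂ) ∈ Metric.ball (x : ℂ) (r x) → y = x) :
    IsConnected ((⋃ x, Metric.ball ((x : ℝ) : ℂ) (r x)) \ ((↑) '' S : Set ℂ)) := by
  set V : ℝ → Set ℂ := fun x => Metric.ball (x : ℂ) (r x) \ ((↑) '' S : Set ℂ) with hV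
  have hVpre : ∀ x, IsPreconnected (V x) := by
    intro x
    by_cases hx : x ∈ S
    · have : V x = Metric.ball (x : ℂ) (r x) \ {(x : ℂ)} := by
        ext z
        simp only [hV, Set.mem_sdiff, Set.mem_image, Set.mem_singleton_iff]
        refine and_congr_right fun hz => not_congr ⟨?_, fun h => ⟨x, hx, h.symm⟩⟩
        rintro ⟨y, hy, rfl⟩
        rw [hS x y hy hz]
      rw [this]
      exact isPreconnected_ball_diff_center _ _
    · have : V x = Metric.ball (x : ℂ) (r x) := by
        ext z
        simp only [hV, Set.mem_sdiff, Set.mem_image, and_iff_left_iff_imp]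
        rintro hz ⟨y, hy, rfl⟩
        exact hx (hS x y hy hz ▸ hy)
      rw [this]
      exact (convex_ball _ _).isPreconnected
  have hnear : ∀ x, ∀ᶠ y in 𝓝 x, (V x ∩ V y).Nonempty ∧ (V y ∩ V x).Nonempty := by
    intro x
    filter_upwards [Metric.ball_mem_nhds x (hr x)] with y hy
    have hy' : (y : ℂ) ∈ Metric.ball (x : ℂ) (r x) := by
      rw [Metric.mem_ball, Complex.dist_eq, ← Complex.ofReal_sub, Complex.norm_real]
      rwa [Metric.mem_ball, Real.dist_eq] at hy
    -- Points just above the real `y` lie in both discs and avoid the real set `S`.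
    have hc : Tendsto (fun t : ℝ => (y : ℂ) + t * Complex.I) (𝓝[>] 0) (𝓝 (y : ℂ)) := by
      have : Continuous fun t : ℝ => (y : ℂ) + t * Complex.I := by fun_prop
      have := this.tendsto 0
      simp only [Complex.ofReal_zero, zero_mul, add_zero] at this
      exact this.mono_left nhdsWithin_le_nhds
    obtain ⟨t, ⟨h1, h2⟩, h3⟩ := ((hc.eventually ((Metric.isOpen_ball.mem_nhds hy'))).and
      (hc.eventually (Metric.ball_mem_nhds (y : ℂ) (hr y)))).and self_mem_nhdsWithin |>.exists
    have hnot : (y : ℂ) + t * Complex.I ∉ ((↑) '' S : Set ℂ) := by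
      rintro ⟨u, -, hu⟩
      have := congrArg Complex.im hu
      simp at this
      exact (ne_of_gt h3) this.symm
    exact ⟨⟨_, ⟨h1, hnot⟩, ⟨h2, hnot⟩⟩, ⟨_, ⟨h2, hnot⟩, ⟨h1, hnot⟩⟩⟩
  have hchain : ∀ x y, Relation.ReflTransGen (fun i j => (V i ∩ V j).Nonempty) x y := by
    intro x
    -- Neighbouring centres have overlapping pieces, so the centres reachable from `x` form a clopen
    -- subset of the connected line.
    have hclopen : IsClopen {y | Relation.ReflTransGen (fun i j => (V i ∩ V j).Nonempty) x y} := by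
      refine ⟨⟨isOpen_iff_mem_nhds.2 fun y hy => ?_⟩, isOpen_iff_mem_nhds.2 fun y hy => ?_⟩
      · filter_upwards [hnear y] with z hz h
        exact hy (h.tail hz.2)
      · filter_upwards [hnear y] with z hz
        exact hy.tail hz.1
    have := hclopen.eq_univ ⟨x, Relation.ReflTransGen.refl⟩
    intro y
    exact this.ge (Set.mem_univ y)
  have hU : (⋃ x, Metric.ball ((x : ℝ) : ℂ) (r x)) \ ((↑) '' S : Set ℂ) = ⋃ x, V x := by
    rw [Set.iUnion_sdiff]
  rw [hU]
  refine ⟨?_, IsPreconnected.iUnion_of_reflTransGen hVpre hchain⟩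
  obtain ⟨z, hz, -⟩ := ((hnear 0).self_of_nhds).1
  exact ⟨z, Set.mem_iUnion.2 ⟨0, hz⟩⟩

end Connectedness

/-- Analytic functions on discs centred on the real line with common values on the real line
glue. -/
theorem exists_glue_real_balls {E : Type*} [NormedAddCommGroup E] [NormedSpace ℂ E] {r : ℝ → ℝ}
    {F : ℝ → E} {G : ℝ → ℂ → E}
    (hG : ∀ x, AnalyticOnNhd ℂ (G x) (Metric.ball (x : ℂ) (r x)))
    (hFG : ∀ x y : ℝ, (y : ℂ) ∈ Metric.ball (x : ℂ) (r x) → F y = G x y) :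
    ∃ K : ℂ → E, ∀ x, Set.EqOn K (G x) (Metric.ball (x : ℂ) (r x)) := by
  classical
  refine ⟨fun z => if h : ∃ x : ℝ, z ∈ Metric.ball (x : ℂ) (r x) then G h.choose z else 0,
    fun x z hz => ?_⟩
  have hex : ∃ x : ℝ, z ∈ Metric.ball (x : ℂ) (r x) := ⟨x, hz⟩
  refine (dif_pos hex).trans ?_
  have hz' := hex.choose_spec
  set x' := hex.choose
  set W := Metric.ball (x : ℂ) (r x) ∩ Metric.ball (x' : ℂ) (r x') with hW
  have hWo : IsOpen W := Metric.isOpen_ball.inter Metric.isOpen_ball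
  -- A disc centred on ℝ contains the real part of each of its points. So an overlap of two discs is
  -- convex and contains a real point, near which both functions equal `F`.
  have hre : ∀ y : ℝ, z ∈ Metric.ball (y : ℂ) (r y) →
      ((z.re : ℝ) : ℂ) ∈ Metric.ball (y : ℂ) (r y) := by
    intro y hy
    rw [Metric.mem_ball, Complex.dist_eq] at hy ⊢
    rw [← Complex.ofReal_sub, Complex.norm_real, Real.norm_eq_abs]
    have := Complex.abs_re_le_norm (z - y)
    rw [Complex.sub_re, Complex.ofReal_re] at this
    exact this.trans_lt hy
  have ht : ((z.re : ℝ) : ℂ) ∈ W := ⟨hre x hz, hre x' hz'⟩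
  refine (AnalyticOnNhd.eqOn_of_preconnected_of_frequently_eq (U := W)
    (fun w hw => hG x' w hw.2) (fun w hw => hG x w hw.1)
    ((convex_ball _ _).inter (convex_ball _ _)).isPreconnected ht ?_) ⟨hz, hz'⟩
  have hev : ∀ᶠ y : ℝ in 𝓝[≠] z.re, G x' y = G x y := by
    refine Filter.Eventually.filter_mono nhdsWithin_le_nhds ?_
    filter_upwards [Complex.continuous_ofReal.continuousAt.preimage_mem_nhds (hWo.mem_nhds ht)]
      with y hy
    rw [← hFG x' y hy.2, ← hFG x y hy.1]
  exact (UnboundedOp.tendsto_ofReal_nhdsNE z.re).frequently hev.frequently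

/-! ### Reduction to a linear pencil and the final assembly -/

namespace UnboundedOp

variable {H : Type*} [NormedAddCommGroup H] [InnerProductSpace ℂ H] [CompleteSpace H]
  {D : Submodule ℂ H}

/-- By Liouville's theorem, an entire family with uniformly bounded derivative is linear in `z`. -/
theorem isSymmetricPencil_of_bounded_deriv (hD : Dense (D : Set H)) {T : ℂ → D →ₗ[ℂ] H}
    (hsa : ∀ x : ℝ, IsSelfAdjoint (LinearPMap.mk D (T (x : ℂ))))
    (hderiv : ∃ C : ℝ, 0 < C ∧ ∀ z : ℂ, ∃ T' : D →ₗ[ℂ] H,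
      HasOpDerivAt T T' z ∧ ∀ f : D, ‖T' f‖ ≤ C * ‖f‖) :
    ∃ B : H →L[ℂ] H, IsSymmetricPencil T B := by
  obtain ⟨C, hC, hT'⟩ := hderiv
  choose T' hd hb using hT'
  have hconst : ∀ z f, T' z f = T' 0 f := by
    intro z f
    refine ext_inner_left ℂ fun g => ?_
    have hdiff : Differentiable ℂ (fun w => inner ℂ g (T w f)) := fun w =>
      (hd w f g).differentiableAt
    have hderiv : deriv (fun w => inner ℂ g (T w f)) = fun w => inner ℂ g (T' w f) :=
      funext fun w => (hd w f g).deriv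
    have hdd : Differentiable ℂ (fun w => inner ℂ g (T' w f)) := by
      rw [← hderiv]
      exact (hdiff.contDiff (n := 2)).differentiable_deriv_two
    refine hdd.apply_eq_apply_of_bounded ?_ z 0
    refine isBounded_iff_forall_norm_le.2 ⟨‖g‖ * (C * ‖f‖), ?_⟩
    rintro _ ⟨w, rfl⟩
    exact (norm_inner_le_norm _ _).trans (mul_le_mul_of_nonneg_left (hb w f) (norm_nonneg _))
  have hlin : ∀ z w f, T z f = T w f + (z - w) • T' 0 f := by
    intro z w f
    refine ext_inner_left ℂ fun g => ?_
    have h0 : ∀ u : ℂ, HasDerivAt (fun v => inner ℂ g (T v f) - v * inner ℂ g (T' 0 f)) 0 u := by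
      intro u
      have := (hd u f g).sub ((hasDerivAt_id u).mul_const (inner ℂ g (T' 0 f)))
      rw [hconst u f, one_mul, sub_self] at this
      exact this
    have := is_const_of_deriv_eq_zero (fun u => (h0 u).differentiableAt)
      (fun u => (h0 u).deriv) z w
    rw [inner_add_right, inner_smul_right]
    linear_combination this
  set b : D →L[ℂ] H := (T' 0).mkContinuous C (hb 0) with hbdef
  have hdr : DenseRange (D.subtypeL : D →L[ℂ] H) := by
    rw [DenseRange]
    convert hD
    exact Subtype.range_coe
  have hui : IsUniformInducing (D.subtypeL : D →L[ℂ] H) := isUniformInducing_val _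
  -- `B` is the continuous extension of the constant derivative from the dense domain.
  refine ⟨b.extend D.subtypeL, ⟨fun z w f => ?_, fun x f g => ?_⟩⟩
  · rw [hlin z w f]
    congr 2
    exact (ContinuousLinearMap.extend_eq b hdr hui f).symm
  · have hadj := (LinearPMap.mk D (T x)).adjoint_isFormalAdjoint hD
    have hsx := hsa x
    rw [LinearPMap.isSelfAdjoint_def] at hsx
    rw [hsx] at hadj
    exact hadj f g

/-- Each real point has a disc on which the eigenprojector property can fail only at the centre. The
real points of failure are therefore closed and discrete, and removing them from the union of the
discs gives `U`. -/
theorem exists_branch_neighbourhood {T : ℂ → D →ₗ[ℂ] H} {m : ℕ} {F : ℝ → ℂ × (H →L[ℂ] H)}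
    (hF : ∀ x, IsRealBranchAt T m F x) :
    ∃ (S : Set ℝ) (U : Set ℂ) (K : ℂ → ℂ × (H →L[ℂ] H)),
      (IsClosed S ∧ DiscreteTopology S) ∧ IsOpen U ∧ IsConnected U ∧
      (∀ x : ℝ, x ∉ S → (x : ℂ) ∈ U) ∧
      (∀ x : ℝ, IsEigenprojector (LinearPMap.mk D (T x)) (F x).1 (F x).2 → x ∉ S) ∧
      (∀ x : ℝ, K x = F x) ∧ AnalyticOnNhd ℂ K U ∧
      ∀ z ∈ U, IsEigenprojector (LinearPMap.mk D (T z)) (K z).1 (K z).2 ∧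
        Module.finrank ℂ (LinearMap.range ((K z).2 : H →ₗ[ℂ] H)) = m := by
  have hloc : ∀ x : ℝ, ∃ (G : ℂ → ℂ × (H →L[ℂ] H)) (r : ℝ), 0 < r ∧
      ∀ z ∈ Metric.ball (x : ℂ) r, AnalyticAt ℂ G z ∧ (z ≠ x →
        IsEigenprojector (LinearPMap.mk D (T z)) (G z).1 (G z).2) ∧
        Module.finrank ℂ (LinearMap.range ((G z).2 : H →ₗ[ℂ] H)) = m ∧
        ∀ y : ℝ, (y : ℂ) = z → F y = G y := by
    intro x
    obtain ⟨G, hG, hFG⟩ := hF x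
    have hFG' : ∀ᶠ z in 𝓝 (x : ℂ), ∀ y : ℝ, (y : ℂ) = z → F y = G y := by
      have : Tendsto Complex.re (𝓝 (x : ℂ)) (𝓝 x) := by
        simpa using Complex.continuous_re.tendsto (x : ℂ)
      filter_upwards [this.eventually hFG] with z hz y hy
      rw [← hy, Complex.ofReal_re] at hz
      exact hz
    obtain ⟨r, hr, hball⟩ := Metric.eventually_nhds_iff_ball.1
      (hG.analyticAt.eventually_analyticAt.and
        ((eventually_nhdsWithin_iff.1 hG.isEigenprojector).and (hG.finrank_eq.and hFG')))
    exact ⟨G, r, hr, hball⟩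
  choose G r hr hball using hloc
  obtain ⟨K, hK⟩ := exists_glue_real_balls (r := r) (F := F) (G := G)
    (fun x z hz => (hball x z hz).1) (fun x y hy => (hball x y hy).2.2.2 y rfl)
  have hKF : ∀ x : ℝ, K x = F x := fun x => by
    have hx := Metric.mem_ball_self (x := (x : ℂ)) (hr x)
    rw [hK x hx, (hball x x hx).2.2.2 x rfl]
  set S : Set ℝ := {x | ¬ IsEigenprojector (LinearPMap.mk D (T x)) (F x).1 (F x).2} with hS
  have hsep : ∀ x : ℝ, ∀ y ∈ S, (y : ℂ) ∈ Metric.ball (x : ℂ) (r x) → y = x := by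
    intro x y hy hyx
    by_contra hne
    refine hy ?_
    rw [(hball x y hyx).2.2.2 y rfl]
    exact (hball x y hyx).2.1 (by exact_mod_cast hne)
  have hpunct : ∀ x : ℝ, ∀ᶠ y in 𝓝[≠] x, y ∉ S := fun x =>
    (hF x).isEigenprojector.mono fun y h h' => h' h
  have hSc : IsClosed S := by
    rw [← isOpen_compl_iff, isOpen_iff_mem_nhds]
    intro x hx
    filter_upwards [eventually_nhdsWithin_iff.1 (hpunct x)] with y hy
    by_cases h : y = x
    · rw [h]; exact hx
    · exact hy h
  refine ⟨S, (⋃ x, Metric.ball ((x : ℝ) : ℂ) (r x)) \ ((↑) '' S : Set ℂ), K, ⟨hSc, ?_⟩, ?_,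
    isConnected_iUnion_ball_diff hr hsep, ?_, fun x h h' => h' h, hKF, ?_, ?_⟩
  · rw [discreteTopology_subtype_iff]
    intro x _
    rw [inf_principal_eq_bot]
    exact hpunct x
  · exact (isOpen_iUnion fun x => Metric.isOpen_ball).sdiff
      (Complex.isometry_ofReal.isClosedEmbedding.isClosedMap _ hSc)
  · intro x hx
    refine ⟨Set.mem_iUnion.2 ⟨x, Metric.mem_ball_self (hr x)⟩, ?_⟩
    rintro ⟨y, hy, hyx⟩
    exact hx (Complex.ofReal_injective hyx ▸ hy)
  · rintro z ⟨hz, -⟩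
    obtain ⟨x, hx⟩ := Set.mem_iUnion.1 hz
    refine (hball x z hx).1.congr ?_
    filter_upwards [Metric.isOpen_ball.mem_nhds hx] with w hw using (hK x hw).symm
  · rintro z ⟨hz, hzS⟩
    obtain ⟨x, hx⟩ := Set.mem_iUnion.1 hz
    rw [hK x hx]
    refine ⟨?_, (hball x z hx).2.2.1⟩
    by_cases hzx : z = x
    · subst hzx
      by_contra h
      exact hzS ⟨x, by rwa [← hK x hx, hKF] at h, rfl⟩
    · exact (hball x z hx).2.1 hzx

end UnboundedOp

theorem theorem1 {H : Type*} [NormedAddCommGroup H] [InnerProductSpace ℂ H] [CompleteSpace H]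
    (D : Submodule ℂ H) (hD : Dense (D : Set H))
    (T : ℂ → D →ₗ[ℂ] H)
    (hclosed : ∀ z : ℂ, (LinearPMap.mk D (T z)).IsClosed)
    (hanalytic : ∀ (f : D) (g : H), AnalyticOnNhd ℂ (fun z => inner ℂ g (T z f)) Set.univ)
    (hsa : ∀ x : ℝ, IsSelfAdjoint (LinearPMap.mk D (T (x : ℂ))))
    (hdisc : ∀ x : ℝ, UnboundedOp.HasDiscreteSpectrum (LinearPMap.mk D (T (x : ℂ))))
    (hderiv : ∃ C : ℝ, 0 < C ∧ ∀ z : ℂ, ∃ T' : D →ₗ[ℂ] H,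
      UnboundedOp.HasOpDerivAt T T' z ∧ ∀ f : D, ‖T' f‖ ≤ C * ‖f‖)
    (a b : EReal) (hab : a < b) (m : ℕ)
    (μ : ℝ → ℝ) (hμ : ContinuousOn μ {x : ℝ | a < (x : EReal) ∧ (x : EReal) < b})
    (hμT : ∀ x : ℝ, a < (x : EReal) → (x : EReal) < b →
      UnboundedOp.IsEigenvalueOfMultiplicity (LinearPMap.mk D (T (x : ℂ))) (μ x : ℂ) m) :
    ∃ (S : Set ℝ) (U : Set ℂ) (μ' : ℂ → ℂ) (P : ℂ → H →L[ℂ] H),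
      (IsClosed S ∧ DiscreteTopology S) ∧
      IsOpen U ∧ IsConnected U ∧
      (∀ x : ℝ, x ∉ S → (x : ℂ) ∈ U) ∧
      (∀ x : ℝ, a < (x : EReal) → (x : EReal) < b → (x : ℂ) ∈ U) ∧
      AnalyticOnNhd ℂ μ' U ∧
      (∀ x : ℝ, a < (x : EReal) → (x : EReal) < b → μ' (x : ℂ) = (μ x : ℂ)) ∧
      (∀ z ∈ U, UnboundedOp.IsEigenvalueOfMultiplicity (LinearPMap.mk D (T z)) (μ' z) m) ∧
      AnalyticOnNhd ℂ P U ∧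
      ∀ z ∈ U, UnboundedOp.IsEigenprojector (LinearPMap.mk D (T z)) (μ' z) (P z) := by
  obtain ⟨B, hT⟩ := UnboundedOp.isSymmetricPencil_of_bounded_deriv hD hsa hderiv
  set J : Set ℝ := {x : ℝ | a < (x : EReal) ∧ (x : EReal) < b} with hJ
  have hJo : IsOpen J := isOpen_Ioo.preimage continuous_coe_real_ereal
  have hJc : J.OrdConnected := ⟨fun x hx y hy z hz =>
    ⟨hx.1.trans_le (EReal.coe_le_coe_iff.2 hz.1), (EReal.coe_le_coe_iff.2 hz.2).trans_lt hy.2⟩⟩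
  obtain ⟨x₀, hax₀, hx₀b⟩ := EReal.lt_iff_exists_real_btwn.1 hab
  have hx₀ : x₀ ∈ J := ⟨hax₀, hx₀b⟩
  have hm0 : m ≠ 0 := (hμT x₀ hax₀ hx₀b).1
  have hlocal : ∀ x ∈ J, ∃ G, UnboundedOp.IsBranchAt T m G x ∧ ∀ᶠ y : ℝ in 𝓝 x,
      (G y).1 = μ y ∧
        UnboundedOp.IsEigenprojector (LinearPMap.mk D (T y)) (μ y : ℝ) (G y).2 := fun x hx =>
    UnboundedOp.exists_isBranchAt_of_constant_multiplicity hT (hdisc x)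
      (hμ.continuousAt (hJo.mem_nhds hx))
      (by filter_upwards [hJo.mem_nhds hx] with y hy using hμT y hy.1 hy.2)
  have hproj : ∀ x ∈ J, ∃ Q : H →L[ℂ] H,
      UnboundedOp.IsEigenprojector (LinearPMap.mk D (T x)) (μ x : ℝ) Q := fun x hx => by
    obtain ⟨G, -, hG⟩ := hlocal x hx
    exact ⟨_, hG.self_of_nhds.2⟩
  -- The pointwise choice is harmless: eigenprojectors are unique, so `Q` agrees locally with the
  -- analytic ones.
  choose! Q hQ using hproj
  have hF₀ : ∀ x ∈ J, UnboundedOp.IsRealBranchAt T m (fun y => ((μ y : ℂ), Q y)) x := by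
    intro x hx
    obtain ⟨G, hG, hGμ⟩ := hlocal x hx
    refine ⟨G, hG, ?_⟩
    filter_upwards [hGμ, hJo.mem_nhds hx] with y h1 h2
    exact Prod.ext h1.1.symm ((hQ y h2).eq h1.2)
  obtain ⟨F, hF, hFF₀⟩ := UnboundedOp.exists_isRealBranchAt_global hT hdisc (x₀ := x₀)
    (by filter_upwards [hJo.mem_nhds hx₀] with x hx using hF₀ x hx)
  have hFJ := UnboundedOp.eqOn_of_isRealBranchAt hJc (fun x _ => hF x) hF₀ hx₀ hFF₀
  obtain ⟨S, U, K, hS, hUo, hUc, hSU, hnotS, hKF, hKa, hK⟩ :=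
    UnboundedOp.exists_branch_neighbourhood hF
  refine ⟨S, U, fun z => (K z).1, fun z => (K z).2, hS, hUo, hUc, hSU, fun x h1 h2 => ?_,
    fun z hz => analyticAt_fst.comp (hKa z hz), fun x h1 h2 => ?_, fun z hz => ⟨hm0, ?_⟩,
    fun z hz => analyticAt_snd.comp (hKa z hz), fun z hz => (hK z hz).1⟩
  -- On (a, b) the continued branch is (μ, Q), whose second entry is a full eigenprojector, so no
  -- point there is exceptional.
  · refine hSU x (hnotS x ?_)
    rw [hFJ ⟨h1, h2⟩]
    exact hQ x ⟨h1, h2⟩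
  · simp only [hKF, hFJ ⟨h1, h2⟩]
  · rw [← (hK z hz).1.2.1, (hK z hz).2]
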